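/- Let $n\ge 2$ be an integer and let $\omega_n$ be the $(n-1)$-dimensional measure of the unit sphere in $\mathbb{R}^n$. A density function is a measurable, compactly supported function $\rho:\mathbb{R}^n\to[0,1]$; put $$V_\rho(x)=\frac{n}{\omega_n}\int_{\mathbb{R}^n}\frac{\rho(\zeta)\,d\zeta}{|x-\zeta|^{n}} .$$ The initial value problem $\mathcal{M}'(t)=1-\mathcal{M}(t)^{2/n}$ for $t\ge 0$, $\mathcal{M}(0)=0$, has a solution on $[0,\infty)$; let $\mathcal{M}_n$ be any such solution. For a density function $\rho$ define $$F_\rho(x)=\begin{cases}\log \mathcal{M}_2(V_\rho(x)), & n=2,\\ \mathcal{M}_n(V_\rho(x))^{(n-2)/n}, & n\ge 3.\end{cases}$$ If $\rho$ is a density function (not almost everywhere zero in the case $n=2$), then $F_\rho$ is subharmonic in $\mathbb{R}^n\setminus\operatorname{supp}\rho$. Moreover, if $B$ is an open or closed Euclidean ball of positive radius and $\rho=\chi_B$ is its characteristic function, then $F_\rho$ is harmonic in $\mathbb{R}^n\setminus\overline{B}$. -/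

import Mathlib

open MeasureTheory Metric Set

noncomputable section

/-- A density function on `ℝⁿ`: (Lebesgue) measurable, compactly supported, with values
in `[0, 1]`. -/
structure IsDensity {n : ℕ} (ρ : EuclideanSpace ℝ (Fin n) → ℝ) : Prop where
  aemeasurable : AEMeasurable ρ volume
  nonneg : ∀ x, 0 ≤ ρ x
  le_one : ∀ x, ρ x ≤ 1
  hasCompactSupport : HasCompactSupport ρ

/-- `ω_n`, the `(n-1)`-dimensional surface measure of the unit sphere of `ℝⁿ`. -/
def sphereArea (n : ℕ) : ℝ :=
  (volume : Measure (EuclideanSpace ℝ (Fin n))).toSphere.real univ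

/-- The potential `V_ρ(x) = (n / ω_n) ∫ ρ(ζ) |x - ζ|^{-n} dζ`. -/
def potentialV {n : ℕ} (ρ : EuclideanSpace ℝ (Fin n) → ℝ) (x : EuclideanSpace ℝ (Fin n)) : ℝ :=
  (n : ℝ) / sphereArea n * ∫ ζ, ρ ζ / ‖x - ζ‖ ^ n

/-- `M` solves `M' = 1 - M^{2/n}`, `M(0) = 0` on `[0, ∞)` (one-sided derivative at `0`).
Values of `M` at negative arguments are irrelevant. -/
def IsProfile (n : ℕ) (M : ℝ → ℝ) : Prop :=
  M 0 = 0 ∧ ∀ t, 0 ≤ t → HasDerivWithinAt M (1 - M t ^ ((2 : ℝ) / n)) (Ici 0) t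

/-- `log M(V_ρ)` if `n = 2`, and `M(V_ρ)^{(n-2)/n}` otherwise. -/
def profileTransform {n : ℕ} (M : ℝ → ℝ) (ρ : EuclideanSpace ℝ (Fin n) → ℝ)
    (x : EuclideanSpace ℝ (Fin n)) : ℝ :=
  if n = 2 then Real.log (M (potentialV ρ x))
  else M (potentialV ρ x) ^ (((n : ℝ) - 2) / n)

/-- `u` is subharmonic on `U`: it is upper semicontinuous, and on every closed ball contained
in `U` it lies below each continuous function that is harmonic in the interior and dominates
`u` on the boundary sphere. -/
def SubharmonicOn {n : ℕ} (u : EuclideanSpace ℝ (Fin n) → ℝ)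
    (U : Set (EuclideanSpace ℝ (Fin n))) : Prop :=
  UpperSemicontinuousOn u U ∧
    ∀ (x : EuclideanSpace ℝ (Fin n)) (r : ℝ), 0 < r → closedBall x r ⊆ U →
      ∀ h : EuclideanSpace ℝ (Fin n) → ℝ, ContinuousOn h (closedBall x r) →
        InnerProductSpace.HarmonicOnNhd h (ball x r) →
        (∀ y ∈ sphere x r, u y ≤ h y) → ∀ y ∈ ball x r, u y ≤ h y

end

/-!
Separation of variables makes a profile `M` the inverse of `profileTime`. By the mean value
property of the Poisson kernel, the potential of a ball of radius `R` at distance `d` from its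
centre is `profileTime (2 / n) ((R / d) ^ n)`, so `M (V) = (R / d) ^ n` and the transform is a
radial harmonic function.

For general `ρ`, the chain rule reduces `0 ≤ ΔF` to `2 ‖∇V‖² ≤ n M(V) ΔV`, an inequality that is
sharp for balls. For every ball having the same potential as `ρ` at `x`, some combination of `V`,
`∇V` and `ΔV` at `x` is the integral of `ρ` against a weight that is negative exactly on that ball,
hence is minimized by the indicator of the ball. Letting the ball vary gives a nonnegative quadratic
polynomial in a vector, and the inequality is the sign of its discriminant along `∇V`.
-/

open Filter Topology InnerProductSpace Laplacian Gradient

section Laplacian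

theorem norm_sub_sq_pos {E : Type*} [NormedAddCommGroup E] {c x : E} (hx : x ≠ c) :
    0 < ‖x - c‖ ^ 2 := by
  have := norm_pos_iff.2 (sub_ne_zero.2 hx)
  positivity

variable {E : Type*} [NormedAddCommGroup E] [InnerProductSpace ℝ E] {f g : E → ℝ}
  {φ φ' : ℝ → ℝ} {φ'' : ℝ} {c x : E}

theorem hasFDerivAt_fderiv_of_contDiffAt_two (hf : ContDiffAt ℝ 2 f x) :
    HasFDerivAt (fderiv ℝ f) (fderiv ℝ (fderiv ℝ f) x) x :=
  ((hf.fderiv_right (m := 1) (by norm_num)).differentiableAt (by norm_num)).hasFDerivAt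

theorem eventually_hasFDerivAt_of_contDiffAt_two (hf : ContDiffAt ℝ 2 f x) :
    ∀ᶠ y in 𝓝 x, HasFDerivAt f (fderiv ℝ f y) y := by
  filter_upwards [hf.eventually (by simp)] with y hy
  exact (hy.differentiableAt (by norm_num)).hasFDerivAt

theorem contDiffAt_norm_sub_sq (c x : E) {k : WithTop ℕ∞} :
    ContDiffAt ℝ k (fun y => ‖y - c‖ ^ 2) x :=
  ((contDiff_id.sub contDiff_const).norm_sq ℝ).contDiffAt

theorem hasFDerivAt_norm_sub_sq (c x : E) :
    HasFDerivAt (fun y => ‖y - c‖ ^ 2) ((2 : ℝ) • innerSL ℝ (x - c)) x := by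
  have := ((hasFDerivAt_id x).sub_const c).norm_sq
  exact this.congr_fderiv (by ext; simp)

variable [FiniteDimensional ℝ E]

theorem laplacian_eq_sum_fderiv_fderiv (f : E → ℝ) (x : E) :
    Δ f x = ∑ i, fderiv ℝ (fderiv ℝ f) x (stdOrthonormalBasis ℝ E i)
      (stdOrthonormalBasis ℝ E i) := by
  simp [laplacian_eq_iteratedFDeriv_stdOrthonormalBasis, iteratedFDeriv_two_apply]

theorem sum_fderiv_mul_fderiv_stdOrthonormalBasis (f g : E → ℝ) (x : E) :
    ∑ i, fderiv ℝ f x (stdOrthonormalBasis ℝ E i) * fderiv ℝ g x (stdOrthonormalBasis ℝ E i) =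
      inner ℝ (∇ f x) (∇ g x) := by
  rw [← (stdOrthonormalBasis ℝ E).sum_inner_mul_inner]
  simp only [inner_gradient_left, inner_gradient_right, conj_trivial]

theorem gradient_comp_of_hasDerivAt {a : ℝ} (hφ : HasDerivAt φ a (f x))
    (hf : DifferentiableAt ℝ f x) : ∇ (fun y => φ (f y)) x = a • ∇ f x := by
  refine ext_inner_right ℝ fun v => ?_
  rw [inner_smul_left, inner_gradient_left, inner_gradient_left,
    HasFDerivAt.fderiv (f := fun y => φ (f y)) (hφ.comp_hasFDerivAt x hf.hasFDerivAt)]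
  simp

theorem laplacian_comp (hf : ContDiffAt ℝ 2 f x)
    (hφ : ∀ᶠ t in 𝓝 (f x), HasDerivAt φ (φ' t) t) (hφ' : HasDerivAt φ' φ'' (f x)) :
    Δ (fun y => φ (f y)) x = φ' (f x) * Δ f x + φ'' * ‖∇ f x‖ ^ 2 := by
  have hfderiv : fderiv ℝ (fun y => φ (f y)) =ᶠ[𝓝 x] fun y => φ' (f y) • fderiv ℝ f y := by
    filter_upwards [eventually_hasFDerivAt_of_contDiffAt_two hf,
      hf.continuousAt.eventually hφ] with y hfy hφy
    exact (hφy.comp_hasFDerivAt y hfy).fderiv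
  have hsecond := ((hφ'.comp_hasFDerivAt x (hf.differentiableAt (by norm_num)).hasFDerivAt).smul
    (hasFDerivAt_fderiv_of_contDiffAt_two hf)).congr_of_eventuallyEq hfderiv
  rw [← real_inner_self_eq_norm_sq, ← sum_fderiv_mul_fderiv_stdOrthonormalBasis,
    laplacian_eq_sum_fderiv_fderiv, laplacian_eq_sum_fderiv_fderiv, hsecond.fderiv,
    Finset.mul_sum, Finset.mul_sum, ← Finset.sum_add_distrib]
  simp [mul_assoc]

theorem laplacian_mul (hf : ContDiffAt ℝ 2 f x) (hg : ContDiffAt ℝ 2 g x) :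
    Δ (fun y => f y * g y) x = f x * Δ g x + g x * Δ f x + 2 * inner ℝ (∇ f x) (∇ g x) := by
  have hfderiv : fderiv ℝ (fun y => f y * g y) =ᶠ[𝓝 x]
      fun y => f y • fderiv ℝ g y + g y • fderiv ℝ f y := by
    filter_upwards [eventually_hasFDerivAt_of_contDiffAt_two hf,
      eventually_hasFDerivAt_of_contDiffAt_two hg] with y hfy hgy
    exact (hfy.mul hgy).fderiv
  have hsecond := (((hf.differentiableAt (by norm_num)).hasFDerivAt.smul
    (hasFDerivAt_fderiv_of_contDiffAt_two hg)).add
    ((hg.differentiableAt (by norm_num)).hasFDerivAt.smul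
      (hasFDerivAt_fderiv_of_contDiffAt_two hf))).congr_of_eventuallyEq hfderiv
  simp only [← sum_fderiv_mul_fderiv_stdOrthonormalBasis, laplacian_eq_sum_fderiv_fderiv,
    hsecond.fderiv, Finset.mul_sum, ← Finset.sum_add_distrib]
  refine Finset.sum_congr rfl fun i _ => ?_
  simp only [_root_.add_apply, _root_.smul_apply, ContinuousLinearMap.smulRight_apply, smul_eq_mul]
  ring

theorem gradient_norm_sub_sq (c x : E) : ∇ (fun y => ‖y - c‖ ^ 2) x = (2 : ℝ) • (x - c) := by
  refine ext_inner_right ℝ fun v => ?_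
  rw [inner_gradient_left, (hasFDerivAt_norm_sub_sq c x).fderiv]
  simp [inner_smul_left, inner_sub_left]

theorem laplacian_norm_sub_sq (c x : E) :
    Δ (fun y => ‖y - c‖ ^ 2) x = 2 * Module.finrank ℝ E := by
  have hfderiv : fderiv ℝ (fun y => ‖y - c‖ ^ 2) = fun y => (2 : ℝ) • innerSL ℝ (y - c) :=
    funext fun y => (hasFDerivAt_norm_sub_sq c y).fderiv
  have hsecond (v : E) : fderiv ℝ (fderiv ℝ fun y => ‖y - c‖ ^ 2) x v v = 2 * inner ℝ v v := by
    have : HasFDerivAt (fun y => (2 : ℝ) • innerSL ℝ (y - c)) ((2 : ℝ) • innerSL ℝ) x :=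
      (((innerSL ℝ).hasFDerivAt (x := x - c)).comp x
        ((hasFDerivAt_id x).sub_const c)).const_smul (2 : ℝ)
    rw [hfderiv, this.fderiv]
    rfl
  simp [laplacian_eq_sum_fderiv_fderiv, hsecond, mul_comm]

theorem gradient_radial {a : ℝ} (hφ : HasDerivAt φ a (‖x - c‖ ^ 2)) :
    ∇ (fun y => φ (‖y - c‖ ^ 2)) x = (2 * a) • (x - c) := by
  rw [gradient_comp_of_hasDerivAt (f := fun y => ‖y - c‖ ^ 2) hφ
    ((contDiffAt_norm_sub_sq c x).differentiableAt one_ne_zero), gradient_norm_sub_sq, smul_smul,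
    mul_comm]

theorem laplacian_radial (hφ : ∀ᶠ t in 𝓝 (‖x - c‖ ^ 2), HasDerivAt φ (φ' t) t)
    (hφ' : HasDerivAt φ' φ'' (‖x - c‖ ^ 2)) :
    Δ (fun y => φ (‖y - c‖ ^ 2)) x =
      2 * Module.finrank ℝ E * φ' (‖x - c‖ ^ 2) + 4 * ‖x - c‖ ^ 2 * φ'' := by
  rw [laplacian_comp (contDiffAt_norm_sub_sq c x) hφ hφ', laplacian_norm_sub_sq,
    gradient_norm_sub_sq, norm_smul]
  norm_num
  ring

/-- The antiderivatives of `C q ^ (-N / 2)` are the radial harmonic functions: logarithms for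
`N = 2` and multiples of the Newtonian kernel otherwise. -/
theorem harmonicAt_radial {C : ℝ} (hx : x ≠ c)
    (hφ : ∀ᶠ t in 𝓝 (‖x - c‖ ^ 2), HasDerivAt φ (C * t ^ (-(Module.finrank ℝ E / 2 : ℝ))) t) :
    HarmonicAt (fun y => φ (‖y - c‖ ^ 2)) x := by
  have hφ_smooth : ContDiffAt ℝ 2 φ (‖x - c‖ ^ 2) := by
    have hφ_deriv : ContDiffAt ℝ 1 (fun t => C * t ^ (-(Module.finrank ℝ E / 2 : ℝ)))
        (‖x - c‖ ^ 2) :=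
      contDiffAt_const.mul (Real.contDiffAt_rpow_const_of_ne (norm_sub_sq_pos hx).ne')
    exact contDiffAt_succ_iff_hasFDerivAt.2
      ⟨_, ⟨_, hφ, fun t ht => HasDerivAt.hasFDerivAt ht⟩,
        ((ContinuousLinearMap.smulRightL ℝ ℝ ℝ 1).contDiff.contDiffAt.comp _ hφ_deriv)⟩
  refine ⟨hφ_smooth.comp x (contDiffAt_norm_sub_sq c x), ?_⟩
  have hnear : ∀ᶠ y in 𝓝 x, ∀ᶠ t in 𝓝 (‖y - c‖ ^ 2),
      HasDerivAt φ (C * t ^ (-(Module.finrank ℝ E / 2 : ℝ))) t :=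
    (contDiffAt_norm_sub_sq c x (k := 0)).continuousAt.eventually hφ.eventually_nhds
  filter_upwards [hnear, isOpen_ne.mem_nhds hx] with y hy hyc
  have hq := (norm_sub_sq_pos hyc).ne'
  rw [laplacian_radial hy ((Real.hasDerivAt_rpow_const (Or.inl hq)).const_mul C),
    Real.rpow_sub_one hq, Pi.zero_apply]
  generalize ‖y - c‖ ^ 2 = q at hq ⊢
  field_simp
  ring

end Laplacian

section MaximumPrinciple

variable {E : Type*} [NormedAddCommGroup E] [InnerProductSpace ℝ E] {f w : E → ℝ} {x : E} {r : ℝ}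

theorem deriv_deriv_nonpos_of_isLocalMax {φ : ℝ → ℝ} {t : ℝ} (hmax : IsLocalMax φ t)
    (hφ : ContinuousAt φ t) : deriv (deriv φ) t ≤ 0 := by
  by_contra! hpos
  have hmin : IsLocalMin φ t := isLocalMin_of_deriv_deriv_pos hpos hmax.deriv_eq_zero hφ
  have hconst : φ =ᶠ[𝓝 t] fun _ => φ t := by
    filter_upwards [hmax, hmin] with s hle hge using le_antisymm hle hge
  have hderiv : deriv φ =ᶠ[𝓝 t] fun _ => 0 := by
    filter_upwards [hconst.eventually_nhds] with s hs
    rw [EventuallyEq.deriv_eq hs, deriv_const]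
  rw [hderiv.deriv_eq, deriv_const] at hpos
  exact hpos.false

theorem fderiv_fderiv_nonpos_of_isLocalMax (hf : ContDiffAt ℝ 2 f x) (hmax : IsLocalMax f x)
    (v : E) : fderiv ℝ (fderiv ℝ f) x v v ≤ 0 := by
  set l : ℝ → E := fun t => x + t • v with hl
  have hl0 : l 0 = x := by simp [hl]
  have hl_deriv (t : ℝ) : HasDerivAt l v t := by
    simpa [hl] using ((hasDerivAt_id t).smul_const v).const_add x
  have hl_tendsto : Tendsto l (𝓝 0) (𝓝 x) := by simpa [hl0] using (hl_deriv 0).continuousAt.tendsto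
  have hderiv : deriv (f ∘ l) =ᶠ[𝓝 0] fun t => fderiv ℝ f (l t) v := by
    filter_upwards [hl_tendsto.eventually (eventually_hasFDerivAt_of_contDiffAt_two hf)] with t ht
    exact (ht.comp_hasDerivAt t (hl_deriv t)).deriv
  have hderiv2 : HasDerivAt (fun t => fderiv ℝ f (l t) v) (fderiv ℝ (fderiv ℝ f) x v v) 0 := by
    have hfl : HasFDerivAt (fderiv ℝ f) (fderiv ℝ (fderiv ℝ f) x) (l 0) := by
      rw [hl0]
      exact hasFDerivAt_fderiv_of_contDiffAt_two hf
    simpa using (hfl.comp_hasDerivAt (0 : ℝ) (hl_deriv 0)).clm_apply (hasDerivAt_const (0 : ℝ) v)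
  rw [← (hderiv2.congr_of_eventuallyEq hderiv).deriv]
  have hmax' : IsLocalMax (f ∘ l) 0 := by
    filter_upwards [hl_tendsto.eventually hmax] with t ht
    simpa [hl0] using ht
  refine deriv_deriv_nonpos_of_isLocalMax hmax' ?_
  exact ContinuousAt.comp (by rw [hl0]; exact hf.continuousAt) (hl_deriv 0).continuousAt

variable [FiniteDimensional ℝ E]

theorem laplacian_nonpos_of_isLocalMax (hf : ContDiffAt ℝ 2 f x) (hmax : IsLocalMax f x) :
    Δ f x ≤ 0 := by
  rw [laplacian_eq_sum_fderiv_fderiv]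
  exact Finset.sum_nonpos fun i _ => fderiv_fderiv_nonpos_of_isLocalMax hf hmax _

theorem nonpos_of_laplacian_pos (hc : ContinuousOn w (closedBall x r))
    (hw : ∀ y ∈ ball x r, ContDiffAt ℝ 2 w y) (hΔ : ∀ y ∈ ball x r, 0 < Δ w y)
    (hs : ∀ y ∈ sphere x r, w y ≤ 0) : ∀ y ∈ closedBall x r, w y ≤ 0 := by
  intro y hy
  obtain ⟨z, hz, hmax⟩ := (isCompact_closedBall x r).exists_isMaxOn ⟨y, hy⟩ hc
  refine (hmax hy).trans ?_
  rcases (mem_closedBall.1 hz).lt_or_eq with hlt | heq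
  · have hloc : IsLocalMax w z := hmax.isLocalMax
      (mem_of_superset (isOpen_ball.mem_nhds hlt) ball_subset_closedBall)
    exact absurd (laplacian_nonpos_of_isLocalMax (hw z hlt) hloc) (hΔ z hlt).not_ge
  · exact hs z heq

theorem nonpos_of_laplacian_nonneg [Nontrivial E] (hc : ContinuousOn w (closedBall x r))
    (hw : ∀ y ∈ ball x r, ContDiffAt ℝ 2 w y) (hΔ : ∀ y ∈ ball x r, 0 ≤ Δ w y)
    (hs : ∀ y ∈ sphere x r, w y ≤ 0) : ∀ y ∈ closedBall x r, w y ≤ 0 := by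
  intro y hy
  have hperturbed (ε : ℝ) (hε : 0 < ε) : w y + ε * (‖y - x‖ ^ 2 - r ^ 2) ≤ 0 := by
    have hq (z : E) : ContDiffAt ℝ 2 (fun z => ε * (‖z - x‖ ^ 2 - r ^ 2)) z :=
      contDiffAt_const.mul ((contDiffAt_norm_sub_sq x z).sub contDiffAt_const)
    have hΔq (z : E) : Δ (fun z => ε * (‖z - x‖ ^ 2 - r ^ 2)) z = 2 * Module.finrank ℝ E * ε := by
      have hφ (t : ℝ) : HasDerivAt (fun t => ε * (t - r ^ 2)) ε t := by
        simpa using ((hasDerivAt_id t).sub_const (r ^ 2)).const_mul ε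
      simpa using laplacian_radial (c := x) (Eventually.of_forall hφ) (hasDerivAt_const _ ε)
    have hN : (0 : ℝ) < Module.finrank ℝ E := mod_cast Module.finrank_pos
    refine nonpos_of_laplacian_pos (w := w + fun z => ε * (‖z - x‖ ^ 2 - r ^ 2))
      (hc.add (by fun_prop)) (fun z hz => (hw z hz).add (hq z)) (fun z hz => ?_)
      (fun z hz => ?_) y hy
    · rw [(hw z hz).laplacian_add (hq z), hΔq]
      have := hΔ z hz
      positivity
    · simpa [← dist_eq_norm, mem_sphere.1 hz] using hs z hz
  have htend : Tendsto (fun ε => w y + ε * (‖y - x‖ ^ 2 - r ^ 2)) (𝓝[>] 0) (𝓝 (w y)) := by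
    have : Continuous fun ε => w y + ε * (‖y - x‖ ^ 2 - r ^ 2) := by fun_prop
    simpa using (this.tendsto 0).mono_left nhdsWithin_le_nhds
  exact le_of_tendsto htend (eventually_mem_nhdsWithin.mono hperturbed)

end MaximumPrinciple

theorem subharmonicOn_of_laplacian_nonneg {n : ℕ} [NeZero n] {u : EuclideanSpace ℝ (Fin n) → ℝ}
    {U : Set (EuclideanSpace ℝ (Fin n))} (hu : ∀ x ∈ U, ContDiffAt ℝ 2 u x)
    (hΔ : ∀ x ∈ U, 0 ≤ Δ u x) : SubharmonicOn u U := by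
  have huc : ContinuousOn u U := fun x hx => (hu x hx).continuousAt.continuousWithinAt
  refine ⟨huc.upperSemicontinuousOn, fun x r _ hball h hc hh hle y hy => ?_⟩
  have hsub : ball x r ⊆ U := ball_subset_closedBall.trans hball
  have := nonpos_of_laplacian_nonneg (w := u - h) ((huc.mono hball).sub hc)
    (fun z hz => (hu z (hsub hz)).sub (hh z hz).1) (fun z hz => ?_)
    (fun z hz => sub_nonpos.2 (hle z hz)) y (ball_subset_closedBall hy)
  · exact sub_nonpos.1 this
  · rw [(hu z (hsub hz)).laplacian_sub (hh z hz).1, (hh z hz).2.self_of_nhds, Pi.zero_apply,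
      sub_zero]
    exact hΔ z (hsub hz)

section Profile

/-- The time at which the solution of `M' = 1 - M ^ p`, `M 0 = 0` reaches the value `m`, obtained
by separation of variables. -/
noncomputable def profileTime (p m : ℝ) : ℝ :=
  ∫ μ in (0 : ℝ)..m, (1 - μ ^ p)⁻¹

variable {p : ℝ}

theorem one_sub_rpow_pos (hp : 0 < p) {m : ℝ} (hm : m ∈ Ico (0 : ℝ) 1) : 0 < 1 - m ^ p :=
  sub_pos.2 (Real.rpow_lt_one hm.1 hm.2 hp)

theorem hasDerivAt_profileTime (hp : 0 < p) {m : ℝ} (hm : m ∈ Ico (0 : ℝ) 1) :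
    HasDerivAt (profileTime p) (1 - m ^ p)⁻¹ m := by
  have hcont {μ : ℝ} (hμ : μ ∈ Ico (0 : ℝ) 1) : ContinuousAt (fun μ : ℝ => (1 - μ ^ p)⁻¹) μ :=
    (continuous_const.sub (Real.continuous_rpow_const hp.le)).continuousAt.inv₀
      (one_sub_rpow_pos hp hμ).ne'
  refine intervalIntegral.integral_hasDerivAt_right ?_ ?_ (hcont hm)
  · refine ContinuousOn.intervalIntegrable fun μ hμ => (hcont ?_).continuousWithinAt
    rw [uIcc_of_le hm.1] at hμ
    exact ⟨hμ.1, hμ.2.trans_lt hm.2⟩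
  · exact ((continuous_const.sub (Real.continuous_rpow_const hp.le)).measurable.inv
      ).stronglyMeasurable.stronglyMeasurableAtFilter

theorem continuousOn_profileTime (hp : 0 < p) : ContinuousOn (profileTime p) (Ico 0 1) :=
  fun _ hm => (hasDerivAt_profileTime hp hm).continuousAt.continuousWithinAt

theorem profileTime_zero : profileTime p 0 = 0 := intervalIntegral.integral_same

theorem sub_le_profileTime_sub (hp : 0 < p) {a b : ℝ} (ha : 0 ≤ a) (hab : a ≤ b) (hb : b < 1) :
    b - a ≤ profileTime p b - profileTime p a := by
  have hderiv : ∀ m ∈ interior (Ico (0 : ℝ) 1),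
      HasDerivAt (profileTime p) (1 - m ^ p)⁻¹ m :=
    fun m hm => hasDerivAt_profileTime hp (interior_subset hm)
  rw [← one_mul (b - a)]
  refine (convex_Ico (0 : ℝ) 1).mul_sub_le_image_sub_of_le_deriv (continuousOn_profileTime hp)
    (fun m hm => (hderiv m hm).differentiableAt.differentiableWithinAt) (fun m hm => ?_)
    a ⟨ha, hab.trans_lt hb⟩ b ⟨ha.trans hab, hb⟩ hab
  rw [(hderiv m hm).deriv]
  refine (one_le_inv₀ (one_sub_rpow_pos hp (interior_subset hm))).2 ?_
  exact sub_le_self 1 (Real.rpow_nonneg (interior_subset hm).1 p)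

theorem le_profileTime (hp : 0 < p) {m : ℝ} (hm : m ∈ Ico (0 : ℝ) 1) : m ≤ profileTime p m := by
  simpa [profileTime_zero] using sub_le_profileTime_sub hp le_rfl hm.1 hm.2

theorem abs_sub_le_abs_profileTime_sub (hp : 0 < p) {a b : ℝ} (ha : a ∈ Ico (0 : ℝ) 1)
    (hb : b ∈ Ico (0 : ℝ) 1) : |a - b| ≤ |profileTime p a - profileTime p b| := by
  rcases le_total a b with h | h
  · rw [abs_sub_comm, abs_sub_comm (profileTime p a), abs_of_nonneg (sub_nonneg.2 h)]
    exact (sub_le_profileTime_sub hp ha.1 h hb.2).trans (le_abs_self _)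
  · rw [abs_of_nonneg (sub_nonneg.2 h)]
    exact (sub_le_profileTime_sub hp hb.1 h ha.2).trans (le_abs_self _)

theorem neg_log_one_sub_le_profileTime (hp : 0 < p) (hp1 : p ≤ 1) {m : ℝ}
    (hm : m ∈ Ico (0 : ℝ) 1) : -Real.log (1 - m) ≤ profileTime p m := by
  have hderiv (x : ℝ) (hx : x ∈ Ico (0 : ℝ) 1) :
      HasDerivAt (fun x => profileTime p x + Real.log (1 - x))
        ((1 - x ^ p)⁻¹ + -1 / (1 - x)) x :=
    (hasDerivAt_profileTime hp hx).add
      (((hasDerivAt_id x).const_sub 1).log (sub_pos.2 hx.2).ne')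
  have hmono : MonotoneOn (fun x => profileTime p x + Real.log (1 - x)) (Ico 0 1) := by
    refine monotoneOn_of_deriv_nonneg (convex_Ico 0 1)
      (fun x hx => (hderiv x hx).continuousAt.continuousWithinAt)
      (fun x hx => (hderiv x (interior_subset hx)).differentiableAt.differentiableWithinAt)
      fun x hx => ?_
    replace hx := interior_subset hx
    have hle : x ≤ x ^ p := Real.self_le_rpow_of_le_one hx.1 hx.2.le hp1
    have hinv := inv_anti₀ (one_sub_rpow_pos hp hx) (sub_le_sub_left hle 1)
    rw [(hderiv x hx).deriv, neg_div, one_div]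
    linarith
  have := hmono (left_mem_Ico.2 one_pos) hm hm.1
  simp only [profileTime_zero, sub_zero, Real.log_one, add_zero] at this
  linarith

theorem exists_profileTime_eq (hp : 0 < p) (hp1 : p ≤ 1) {t : ℝ} (ht : 0 ≤ t) :
    ∃ m ∈ Ico (0 : ℝ) 1, profileTime p m = t := by
  have hb : 1 - Real.exp (-t) ∈ Ico (0 : ℝ) 1 :=
    ⟨sub_nonneg.2 (Real.exp_le_one_iff.2 (neg_nonpos.2 ht)), sub_lt_self 1 (Real.exp_pos _)⟩
  have hle : t ≤ profileTime p (1 - Real.exp (-t)) := by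
    simpa using neg_log_one_sub_le_profileTime hp hp1 hb
  have hsub : Icc 0 (1 - Real.exp (-t)) ⊆ Ico 0 1 := Icc_subset_Ico_right hb.2
  obtain ⟨m, hm, hmt⟩ := intermediate_value_Icc hb.1 ((continuousOn_profileTime hp).mono hsub)
    ⟨profileTime_zero.le.trans ht, hle⟩
  exact ⟨m, hsub hm, hmt⟩

variable {n : ℕ} {M : ℝ → ℝ}

theorem two_div_natCast_pos (hn : 2 ≤ n) : (0 : ℝ) < 2 / n := by
  have : 0 < n := by lia
  positivity

theorem two_div_natCast_le_one (hn : 2 ≤ n) : (2 : ℝ) / n ≤ 1 :=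
  div_le_one_of_le₀ (mod_cast hn) n.cast_nonneg

theorem exists_isProfile (hn : 2 ≤ n) : ∃ M : ℝ → ℝ, IsProfile n M := by
  have hp := two_div_natCast_pos hn
  choose! M hM_mem hM using fun t => exists_profileTime_eq hp (two_div_natCast_le_one hn) (t := t)
  have hlip : LipschitzOnWith 1 M (Ici 0) := LipschitzOnWith.of_dist_le_mul fun s hs t ht => by
    simpa [Real.dist_eq, hM s hs, hM t ht] using
      abs_sub_le_abs_profileTime_sub hp (hM_mem s hs) (hM_mem t ht)
  refine ⟨M, ?_, fun t ht => ?_⟩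
  · have h0 := le_profileTime hp (hM_mem 0 le_rfl)
    exact le_antisymm (by rwa [hM 0 le_rfl] at h0) (hM_mem 0 le_rfl).1
  · have hpos := one_sub_rpow_pos hp (hM_mem t ht)
    have hT := ((hasDerivAt_profileTime hp (hM_mem t ht)).hasFDerivAt_equiv
      (inv_ne_zero hpos.ne')).hasFDerivWithinAt (s := univ)
    have := hT.of_local_left_inverse (s := Ici 0)
      (by rw [nhdsWithin_univ]; exact hlip.continuousOn t ht) ht
      (eventually_mem_nhdsWithin.mono hM)
    simpa using this.hasDerivWithinAt

namespace IsProfile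

theorem continuousOn (hM : IsProfile n M) : ContinuousOn M (Ici 0) := fun t ht =>
  (hM.2 t ht).continuousWithinAt

theorem hasDerivAt (hM : IsProfile n M) {t : ℝ} (ht : 0 < t) :
    HasDerivAt M (1 - M t ^ ((2 : ℝ) / n)) t :=
  (hM.2 t ht.le).hasDerivAt (Ici_mem_nhds ht)

theorem nonneg (hM : IsProfile n M) (hn : n ≠ 0) {t : ℝ} (ht : 0 ≤ t) : 0 ≤ M t := by
  have := image_le_of_deriv_right_lt_deriv_boundary (f := fun x => -M x)
    (f' := fun x => -(1 - M x ^ ((2 : ℝ) / n))) (a := 0) (b := t) (B := fun _ => 0)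
    (B' := fun _ => 0) ((hM.continuousOn.mono Icc_subset_Ici_self).neg)
    (fun x hx => ((hM.2 x hx.1).mono (Ici_subset_Ici.2 hx.1)).neg) (by simp [hM.1])
    (fun x => hasDerivAt_const x 0) (fun x _ h => by
      rw [neg_eq_zero.1 h, Real.zero_rpow (by positivity)]
      norm_num) (right_mem_Icc.2 ht)
  simpa using this

/-- Both sides solve the same equation, and `(M (T x) - x) ^ 2` is decreasing because
`1 - m ^ (2 / n)` decreases in `m`. -/
theorem apply_profileTime (hM : IsProfile n M) (hn : n ≠ 0) {m : ℝ} (hm : m ∈ Ico (0 : ℝ) 1) :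
    M (profileTime (2 / n) m) = m := by
  have hp : (0 : ℝ) < 2 / n := by positivity
  set e : ℝ → ℝ := fun x => M (profileTime (2 / n) x) - x
  have he_cont : ContinuousOn e (Ico 0 1) :=
    (hM.continuousOn.comp (continuousOn_profileTime hp)
      fun x hx => hx.1.trans (le_profileTime hp hx)).sub continuousOn_id
  have he_deriv {x : ℝ} (hx : x ∈ Ioo (0 : ℝ) 1) : HasDerivAt (fun x => e x ^ 2)
      (2 * e x * ((x ^ (2 / n : ℝ) - M (profileTime (2 / n) x) ^ (2 / n : ℝ)) *
        (1 - x ^ (2 / n : ℝ))⁻¹)) x := by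
    have hx' := Ioo_subset_Ico_self hx
    have hM_comp := (hM.hasDerivAt (hx.1.trans_le (le_profileTime hp hx'))).comp x
      (hasDerivAt_profileTime hp hx')
    refine ((hM_comp.sub (hasDerivAt_id x)).pow 2).congr_deriv ?_
    have := (one_sub_rpow_pos hp hx').ne'
    simp only [e, Function.comp_apply, Pi.sub_apply, id_eq]
    field_simp
    ring
  have hanti : AntitoneOn (fun x => e x ^ 2) (Ico 0 1) := by
    refine antitoneOn_of_deriv_nonpos (convex_Ico 0 1) (he_cont.pow 2) ?_ ?_ <;>
      rw [interior_Ico]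
    · exact fun x hx => (he_deriv hx).differentiableAt.differentiableWithinAt
    · intro x hx
      have hx' := Ioo_subset_Ico_self hx
      have hMx := hM.nonneg hn (hx.1.le.trans (le_profileTime hp hx'))
      rw [(he_deriv hx).deriv, ← mul_assoc]
      refine mul_nonpos_of_nonpos_of_nonneg ?_ (inv_nonneg.2 (one_sub_rpow_pos hp hx').le)
      rcases le_total x (M (profileTime (2 / n) x)) with h | h
      · exact mul_nonpos_of_nonneg_of_nonpos (mul_nonneg zero_le_two (sub_nonneg.2 h))
          (sub_nonpos.2 (Real.rpow_le_rpow hx.1.le h hp.le))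
      · exact mul_nonpos_of_nonpos_of_nonneg
          (mul_nonpos_of_nonneg_of_nonpos zero_le_two (sub_nonpos.2 h))
          (sub_nonneg.2 (Real.rpow_le_rpow hMx h hp.le))
  have hle := hanti (left_mem_Ico.2 one_pos) hm hm.1
  simp only [e, profileTime_zero, hM.1, sub_self, ne_eq, OfNat.ofNat_ne_zero, not_false_eq_true,
    zero_pow] at hle
  exact sub_eq_zero.1 (pow_eq_zero_iff two_ne_zero |>.1 (le_antisymm hle (sq_nonneg _)))

theorem mem_Ico (hM : IsProfile n M) (hn : 2 ≤ n) {t : ℝ} (ht : 0 ≤ t) : M t ∈ Ico 0 1 := by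
  obtain ⟨m, hm, rfl⟩ := exists_profileTime_eq (two_div_natCast_pos hn)
    (two_div_natCast_le_one hn) ht
  rwa [hM.apply_profileTime (by lia) hm]

theorem profileTime_apply (hM : IsProfile n M) (hn : 2 ≤ n) {t : ℝ} (ht : 0 ≤ t) :
    profileTime (2 / n) (M t) = t := by
  obtain ⟨m, hm, rfl⟩ := exists_profileTime_eq (two_div_natCast_pos hn)
    (two_div_natCast_le_one hn) ht
  rw [hM.apply_profileTime (by lia) hm]

theorem mem_Ioo (hM : IsProfile n M) (hn : 2 ≤ n) {t : ℝ} (ht : 0 < t) : M t ∈ Ioo 0 1 := by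
  obtain ⟨h0, h1⟩ := hM.mem_Ico hn ht.le
  refine ⟨h0.lt_of_ne fun h => ht.ne ?_, h1⟩
  rw [← hM.profileTime_apply hn ht.le, ← h, profileTime_zero]

theorem contDiffOn (hM : IsProfile n M) (hn : 2 ≤ n) (k : ℕ) : ContDiffOn ℝ k M (Ioi 0) := by
  induction k with
  | zero =>
    exact contDiffOn_zero.2 (hM.continuousOn.mono Ioi_subset_Ici_self)
  | succ k ih =>
    rw [Nat.cast_succ, contDiffOn_succ_iff_deriv_of_isOpen isOpen_Ioi]
    refine ⟨fun t ht => (hM.hasDerivAt ht).differentiableAt.differentiableWithinAt,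
      fun h => absurd h (by simp), ?_⟩
    exact (contDiffOn_const.sub (ih.rpow_const_of_ne fun t ht => (hM.mem_Ioo hn ht).1.ne')).congr
      fun t ht => (hM.hasDerivAt ht).deriv

end IsProfile

end Profile

section PolarCoordinates

variable {E : Type*} [NormedAddCommGroup E] [NormedSpace ℝ E] [FiniteDimensional ℝ E]
  [MeasurableSpace E] [BorelSpace E] {μ : Measure E} [μ.IsAddHaarMeasure]

theorem integral_eq_integral_Ioi_integral_sphere [Nontrivial E] {f : E → ℝ} (hf : Integrable f μ) :
    ∫ x, f x ∂μ = ∫ r in Ioi (0 : ℝ), r ^ (Module.finrank ℝ E - 1) *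
      ∫ θ : sphere (0 : E) 1, f (r • (θ : E)) ∂μ.toSphere := by
  set F : sphere (0 : E) 1 × Ioi (0 : ℝ) → ℝ := fun p => f ((p.2 : ℝ) • (p.1 : E))
  have hF (x : ({0}ᶜ : Set E)) : F (homeomorphUnitSphereProd E x) = f x := by
    have hx : (x : E) ≠ 0 := x.2
    simp [F, smul_smul, norm_ne_zero_iff.2 hx]
  have hpolar := μ.measurePreserving_homeomorphUnitSphereProd
  have hemb := (homeomorphUnitSphereProd E).measurableEmbedding
  have hF_int : Integrable F (μ.toSphere.prod (.volumeIoiPow (Module.finrank ℝ E - 1))) := by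
    rw [← hpolar.integrable_comp_emb hemb, Function.comp_def]
    simp only [hF]
    exact (integrableOn_iff_comap_subtypeVal (measurableSet_singleton _).compl).1 hf.integrableOn
  calc ∫ x, f x ∂μ = ∫ x : ({0}ᶜ : Set E), F (homeomorphUnitSphereProd E x) ∂μ.comap (↑) := by
        simp only [hF]
        rw [integral_subtype_comap (measurableSet_singleton _).compl, restrict_compl_singleton]
    _ = ∫ r : Ioi (0 : ℝ), ∫ θ, F (θ, r) ∂μ.toSphere ∂.volumeIoiPow (Module.finrank ℝ E - 1) := by
        rw [hpolar.integral_comp hemb, integral_prod_symm _ hF_int]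
    _ = _ := by
        simp only [Measure.volumeIoiPow, ENNReal.ofReal]
        rw [integral_withDensity_eq_integral_smul
            (measurable_subtype_coe.pow_const _).real_toNNReal,
          integral_subtype_comap measurableSet_Ioi fun r : ℝ =>
            Real.toNNReal (r ^ (Module.finrank ℝ E - 1)) • ∫ θ, f (r • (θ : E)) ∂μ.toSphere]
        refine setIntegral_congr_fun measurableSet_Ioi fun r (hr : 0 < r) => ?_
        simp only [NNReal.smul_def, Real.coe_toNNReal _ (pow_nonneg hr.le _), smul_eq_mul]

theorem continuousOn_integral_sphere {f : E → ℝ} {d : ℝ} (hf : ContinuousOn f (ball 0 d)) :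
    ContinuousOn (fun r : ℝ => ∫ θ : sphere (0 : E) 1, f (r • (θ : E)) ∂μ.toSphere)
      (Ioo (-d) d) := by
  rw [continuousOn_iff_continuous_domRestrict]
  have : LocallyCompactSpace (Ioo (-d) d) := isOpen_Ioo.locallyCompactSpace
  have hcont : Continuous (Function.uncurry fun (r : Ioo (-d) d) (θ : sphere (0 : E) 1) =>
      f ((r : ℝ) • (θ : E))) := by
    refine hf.comp_continuous (by fun_prop) fun p => ?_
    simp only [mem_ball_zero_iff, norm_smul, norm_eq_of_mem_sphere, mul_one]
    exact abs_lt.2 p.1.2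
  simpa [Set.domRestrict_def] using
    continuous_parametric_integral_of_continuous (μ := μ.toSphere) hcont isCompact_univ

end PolarCoordinates

section RadialSupport

variable {g : ℝ → ℝ} {d s : ℝ}

theorem tsupport_comp_norm_subset_closedBall {E : Type*} [SeminormedAddCommGroup E]
    (hg : ∀ r, s ≤ r → g r = 0) : tsupport (fun y : E => g ‖y‖) ⊆ closedBall 0 s := by
  refine closure_minimal (fun y hy => ?_) isClosed_closedBall
  by_contra hys
  exact hy (hg _ (le_of_lt (by simpa using hys)))

theorem exists_forall_ge_eq_zero (hd : 0 < d) (hg : HasCompactSupport g)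
    (hgd : tsupport g ⊆ Iio d) : ∃ s, 0 ≤ s ∧ s < d ∧ ∀ r, s ≤ r → g r = 0 := by
  obtain ⟨t, ht, htmax⟩ := (hg.isCompact.insert 0).exists_isGreatest (insert_nonempty _ _)
  have htd : t < d := ht.elim (fun h => h ▸ hd) fun h => hgd h
  obtain ⟨s, hts, hsd⟩ := exists_between htd
  refine ⟨s, (htmax (mem_insert _ _)).trans hts.le, hsd, fun r hr => ?_⟩
  by_contra h
  exact absurd (htmax (mem_insert_of_mem _ (subset_tsupport g h))) (by linarith)

end RadialSupport

section Green

variable {E : Type*} [NormedAddCommGroup E] [InnerProductSpace ℝ E] [FiniteDimensional ℝ E]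
  [MeasurableSpace E] [BorelSpace E] {μ : Measure E} [μ.IsAddHaarMeasure] {u : E → ℝ} {d s : ℝ}

theorem integral_mul_laplacian {ψ : E → ℝ} (hψ : ContDiff ℝ 1 ψ) (hψc : HasCompactSupport ψ)
    (hu : ∀ x ∈ tsupport ψ, ContDiffAt ℝ 2 u x) :
    ∫ x, ψ x * Δ u x ∂μ = -∫ x, inner ℝ (∇ ψ x) (∇ u x) ∂μ := by
  have hu_deriv (x) (hx : x ∈ tsupport ψ) : ContDiffAt ℝ 1 (fderiv ℝ u) x :=
    (hu x hx).fderiv_right (by norm_num)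
  have hint {χ w : E → ℝ} (hχ : Continuous χ) (hχs : tsupport χ ⊆ tsupport ψ)
      (hw : ∀ x ∈ tsupport ψ, ContinuousAt w x) : Integrable (fun x => χ x * w x) μ :=
    (continuous_of_tsupport fun x hx => hχ.continuousAt.mul
      (hw x (hχs (tsupport_mul_subset_left hx)))).integrable_of_hasCompactSupport
        (HasCompactSupport.mul_right (hψc.mono' (subset_tsupport _ |>.trans hχs)))
  have hψ_deriv (e : E) : Continuous fun x => fderiv ℝ ψ x e :=
    (hψ.continuous_fderiv one_ne_zero).clm_apply continuous_const
  have hψ_supp (e : E) : tsupport (fun x => fderiv ℝ ψ x e) ⊆ tsupport ψ :=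
    tsupport_fderiv_apply_subset ℝ e
  have hint_grad (e : E) : Integrable (fun x => fderiv ℝ ψ x e * fderiv ℝ u x e) μ :=
    hint (hψ_deriv e) (hψ_supp e) fun x hx =>
      (hu_deriv x hx).continuousAt.clm_apply continuousAt_const
  have hint_hess (e : E) : Integrable (fun x => ψ x * fderiv ℝ (fderiv ℝ u) x e e) μ :=
    hint hψ.continuous subset_rfl fun x hx =>
      (((hu_deriv x hx).fderiv_right (m := 0) (by norm_num)).continuousAt.clm_apply
        continuousAt_const).clm_apply continuousAt_const
  have hparts (e : E) : ∫ x, ψ x * fderiv ℝ (fderiv ℝ u) x e e ∂μ =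
      -∫ x, fderiv ℝ ψ x e * fderiv ℝ u x e ∂μ := by
    simpa using integral_bilinear_hasFDerivAt_right_eq_neg_left_of_integrable (μ := μ) (f := ψ)
      (g' := fun x => (fderiv ℝ (fderiv ℝ u) x).flip e) (v := e) (B := ContinuousLinearMap.mul ℝ ℝ)
      (by simpa using hint_grad e) (by simpa using hint_hess e)
      (by simpa using hint hψ.continuous subset_rfl fun x hx =>
        (hu_deriv x hx).continuousAt.clm_apply continuousAt_const)
      (fun x _ => (hψ.differentiable one_ne_zero x).hasFDerivAt)
      (fun x hx => ((hasFDerivAt_fderiv_of_contDiffAt_two (hu x hx)).clm_apply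
        (hasFDerivAt_const e x)).congr_fderiv (by ext; simp))
  calc ∫ x, ψ x * Δ u x ∂μ = ∑ i, ∫ x, ψ x * fderiv ℝ (fderiv ℝ u) x
        (stdOrthonormalBasis ℝ E i) (stdOrthonormalBasis ℝ E i) ∂μ := by
        simp only [laplacian_eq_sum_fderiv_fderiv, Finset.mul_sum]
        exact integral_finsetSum _ fun i _ => hint_hess _
    _ = -∫ x, inner ℝ (∇ ψ x) (∇ u x) ∂μ := by
        simp only [hparts, Finset.sum_neg_distrib, ← sum_fderiv_mul_fderiv_stdOrthonormalBasis]
        rw [integral_finsetSum _ fun i _ => hint_grad _]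

theorem integral_radial_mul_fderiv_apply_self (hu : HarmonicOnNhd u (ball 0 d)) (hs : 0 ≤ s)
    (hsd : s < d) {g : ℝ → ℝ} (hg : Continuous g) (hg0 : ∀ r, s ≤ r → g r = 0) :
    ∫ y, g ‖y‖ * fderiv ℝ u y y ∂μ = 0 := by
  -- `ψ` is the radial potential with `∇ψ(y) = g(‖y‖) y`.
  set Θ : ℝ → ℝ := fun q => (∫ p in (s ^ 2)..q, g √p) / 2
  have hΘ (q : ℝ) : HasDerivAt Θ (g √q / 2) q :=
    ((hg.comp Real.continuous_sqrt).integral_hasStrictDerivAt (s ^ 2) q).hasDerivAt.div_const 2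
  have hΘ0 (q : ℝ) (hq : s ^ 2 ≤ q) : Θ q = 0 := by
    have : EqOn (fun p => g √p) 0 (uIcc (s ^ 2) q) := fun p hp => by
      rw [uIcc_of_le hq] at hp
      exact hg0 _ (Real.le_sqrt_of_sq_le hp.1)
    simp [Θ, intervalIntegral.integral_congr this]
  set ψ : E → ℝ := fun y => Θ (‖y - 0‖ ^ 2)
  have hψ : ContDiff ℝ 1 ψ := by
    have hΘ_smooth : ContDiff ℝ 1 Θ := by
      refine contDiff_one_iff_deriv.2 ⟨fun q => (hΘ q).differentiableAt, ?_⟩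
      rw [funext fun q => (hΘ q).deriv]
      fun_prop
    exact hΘ_smooth.comp ((contDiff_id.sub contDiff_const).norm_sq ℝ)
  have hψ_grad (y : E) : ∇ ψ y = g ‖y‖ • y := by
    rw [gradient_radial (hΘ _)]
    simp [mul_div_cancel₀]
  have hψ_supp : tsupport ψ ⊆ closedBall 0 s := by
    simpa [ψ] using tsupport_comp_norm_subset_closedBall (E := E) (g := fun r => Θ (r ^ 2))
      fun r hr => hΘ0 _ (by gcongr)
  have hgreen := integral_mul_laplacian (μ := μ) hψ
    ((isCompact_closedBall 0 s).of_isClosed_subset (isClosed_tsupport _) hψ_supp)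
    fun y hy => (hu y (closedBall_subset_ball hsd (hψ_supp hy))).1
  have hzero (y : E) : ψ y * Δ u y = 0 := by
    by_cases hy : y ∈ tsupport ψ
    · simp [(hu y (closedBall_subset_ball hsd (hψ_supp hy))).2.self_of_nhds]
    · simp [image_eq_zero_of_notMem_tsupport hy]
  simpa [hzero, hψ_grad, inner_smul_left, inner_gradient_right] using hgreen

variable [Nontrivial E]

theorem ae_integral_sphere_fderiv_eq_zero (hd : 0 < d)
    (hu : HarmonicOnNhd u (ball 0 d)) : ∀ᵐ r : ℝ, r ∈ Ioo 0 d →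
      ∫ θ : sphere (0 : E) 1, fderiv ℝ u (r • (θ : E)) θ ∂μ.toSphere = 0 := by
  set A : ℝ → ℝ := fun r =>
    ∫ θ : sphere (0 : E) 1, fderiv ℝ u (r • (θ : E)) (r • (θ : E)) ∂μ.toSphere
  have hfu : ContinuousOn (fun y => fderiv ℝ u y y) (ball 0 d) := fun y hy =>
    ((hasFDerivAt_fderiv_of_contDiffAt_two (hu y hy).1).continuousAt.clm_apply
      continuousAt_id).continuousWithinAt
  have hA : ContinuousOn A (Ioo 0 d) :=
    (continuousOn_integral_sphere hfu).mono fun r hr => ⟨by linarith [hr.1, hr.2], hr.2⟩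
  have hA_ae : ∀ᵐ r : ℝ, r ∈ Ioo 0 d → r ^ (Module.finrank ℝ E - 1) * A r = 0 := by
    refine isOpen_Ioo.ae_eq_zero_of_integral_contDiff_smul_eq_zero
      (((continuousOn_pow _).mul hA).locallyIntegrableOn measurableSet_Ioo)
      fun g hg hgc hgs => ?_
    obtain ⟨s, hs, hsd, hg0⟩ := exists_forall_ge_eq_zero hd hgc (hgs.trans Ioo_subset_Iio_self)
    have hf_supp := tsupport_comp_norm_subset_closedBall (E := E) hg0
    have hf_int : Integrable (fun y => g ‖y‖ * fderiv ℝ u y y) μ := by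
      refine (continuous_of_tsupport fun y hy => ?_).integrable_of_hasCompactSupport
        ((isCompact_closedBall 0 s).of_isClosed_subset (isClosed_tsupport _)
          (tsupport_mul_subset_left.trans hf_supp))
      exact (hg.continuous.comp continuous_norm).continuousAt.mul
        (hfu.continuousAt (isOpen_ball.mem_nhds
          (closedBall_subset_ball hsd (hf_supp (tsupport_mul_subset_left hy)))))
    rw [← integral_radial_mul_fderiv_apply_self (μ := μ) hu hs hsd
        hg.continuous hg0, integral_eq_integral_Ioi_integral_sphere hf_int,
      ← setIntegral_eq_integral_of_forall_compl_eq_zero (s := Ioi 0) fun r hr => by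
        rw [image_eq_zero_of_notMem_tsupport fun h => hr (hgs h).1, zero_smul]]
    refine setIntegral_congr_fun measurableSet_Ioi fun r (hr : 0 < r) => ?_
    simp only [norm_smul, norm_eq_of_mem_sphere, mul_one, Real.norm_of_nonneg hr.le,
      integral_const_mul, smul_eq_mul, A]
    ring
  filter_upwards [hA_ae] with r hr hrd
  have := hr hrd
  simpa [A, integral_const_mul, hrd.1.ne'] using this

theorem integral_sphere_eq_of_harmonicOnNhd (hu : HarmonicOnNhd u (ball 0 d)) {r : ℝ}
    (hr : 0 ≤ r) (hrd : r < d) :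
    ∫ θ : sphere (0 : E) 1, u (r • (θ : E)) ∂μ.toSphere = μ.toSphere.real univ * u 0 := by
  have hmem (t : ℝ) (ht : t ∈ uIcc 0 r) (θ : sphere (0 : E) 1) : t • (θ : E) ∈ ball (0 : E) d := by
    rw [uIcc_of_le hr] at ht
    simpa [norm_smul, abs_of_nonneg ht.1] using ht.2.trans_lt hrd
  have hderiv_cont : ContinuousOn
      (Function.uncurry fun (t : ℝ) (θ : sphere (0 : E) 1) => fderiv ℝ u (t • (θ : E)) θ)
      (uIcc 0 r ×ˢ univ) := by
    rintro ⟨t, θ⟩ ⟨ht, -⟩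
    have : ContinuousAt (fun p : ℝ × sphere (0 : E) 1 => fderiv ℝ u (p.1 • (p.2 : E))) (t, θ) :=
      ContinuousAt.comp (f := fun p : ℝ × sphere (0 : E) 1 => p.1 • (p.2 : E))
        (hasFDerivAt_fderiv_of_contDiffAt_two (hu _ (hmem t ht θ)).1).continuousAt (by fun_prop)
    exact (this.clm_apply (by fun_prop)).continuousWithinAt
  have hftc (θ : sphere (0 : E) 1) :
      ∫ t in (0 : ℝ)..r, fderiv ℝ u (t • (θ : E)) θ = u (r • (θ : E)) - u 0 := by
    rw [intervalIntegral.integral_eq_sub_of_hasDerivAt (f := fun t : ℝ => u (t • (θ : E)))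
      (fun t ht => ((hu _ (hmem t ht θ)).1.differentiableAt two_ne_zero).hasFDerivAt.comp_hasDerivAt
        t (by simpa using (hasDerivAt_id t).smul_const (θ : E)))]
    · simp
    · exact (hderiv_cont.comp (f := fun t => (t, θ)) (by fun_prop)
        fun t ht => ⟨ht, mem_univ _⟩).intervalIntegrable
  have hzero : ∫ θ : sphere (0 : E) 1, (u (r • (θ : E)) - u 0) ∂μ.toSphere = 0 := by
    simp only [← hftc]
    rw [← intervalIntegral_integral_swap]
    · refine intervalIntegral.integral_zero_ae ?_
      filter_upwards [ae_integral_sphere_fderiv_eq_zero (μ := μ) (hr.trans_lt hrd) hu] with t ht htr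
      rw [uIoc_of_le hr] at htr
      exact ht ⟨htr.1, htr.2.trans_lt hrd⟩
    · rw [← Measure.restrict_univ (μ := μ.toSphere), Measure.prod_restrict]
      exact (hderiv_cont.integrableOn_compact (isCompact_uIcc.prod isCompact_univ)).mono_set
        (prod_mono_left uIoc_subset_uIcc)
  rw [integral_sub _ (integrable_const _), sub_eq_zero] at hzero
  · simpa using hzero
  · have hcont : Continuous fun θ : sphere (0 : E) 1 => u (r • (θ : E)) :=
      hu.continuousOn.comp_continuous (by fun_prop) fun θ => hmem r right_mem_uIcc θ
    exact hcont.integrable_of_hasCompactSupport (.of_compactSpace _)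

end Green

section PoissonKernel

variable {E : Type*} [NormedAddCommGroup E] [InnerProductSpace ℝ E] {c x : E}

theorem contDiffAt_rpow_norm_sub_sq (hx : x ≠ c) (a : ℝ) {k : WithTop ℕ∞} :
    ContDiffAt ℝ k (fun y => (‖y - c‖ ^ 2) ^ a) x :=
  (Real.contDiffAt_rpow_const_of_ne (norm_sub_sq_pos hx).ne').comp x (contDiffAt_norm_sub_sq c x)

theorem rpow_sq_neg_half {r : ℝ} (hr : 0 ≤ r) (k : ℕ) : (r ^ 2) ^ (-(k / 2 : ℝ)) = (r ^ k)⁻¹ := by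
  rw [Real.rpow_neg (sq_nonneg r), ← Real.rpow_natCast_mul hr, ← Real.rpow_natCast r k]
  congr 2
  push_cast
  ring

variable [FiniteDimensional ℝ E]

theorem gradient_rpow_norm_sub_sq (hx : x ≠ c) (a : ℝ) :
    ∇ (fun y => (‖y - c‖ ^ 2) ^ a) x = (2 * a * (‖x - c‖ ^ 2) ^ (a - 1)) • (x - c) := by
  rw [gradient_radial (φ := fun q => q ^ a)
    (Real.hasDerivAt_rpow_const (Or.inl (norm_sub_sq_pos hx).ne')), mul_assoc]

theorem laplacian_rpow_norm_sub_sq (hx : x ≠ c) (a : ℝ) :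
    Δ (fun y => (‖y - c‖ ^ 2) ^ a) x =
      2 * a * (Module.finrank ℝ E + 2 * a - 2) * (‖x - c‖ ^ 2) ^ (a - 1) := by
  have hq := norm_sub_sq_pos hx
  have hderiv : ∀ᶠ t in 𝓝 (‖x - c‖ ^ 2), HasDerivAt (fun q => q ^ a) (a * t ^ (a - 1)) t := by
    filter_upwards [isOpen_ne.mem_nhds hq.ne'] with t ht
    exact Real.hasDerivAt_rpow_const (Or.inl ht)
  rw [laplacian_radial hderiv ((Real.hasDerivAt_rpow_const (Or.inl hq.ne')).const_mul a),
    Real.rpow_sub_one hq.ne' (a - 1)]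
  generalize ‖x - c‖ ^ 2 = q at hq
  field_simp
  ring

theorem harmonicOnNhd_poissonKernel (z : E) :
    HarmonicOnNhd (fun y => (‖z‖ ^ 2 - ‖y - 0‖ ^ 2) *
      (‖y - z‖ ^ 2) ^ (-(Module.finrank ℝ E / 2 : ℝ))) (ball 0 ‖z‖) := by
  have hne (y : E) (hy : y ∈ ball 0 ‖z‖) : y ≠ z := by
    rintro rfl
    simp at hy
  have hderiv (t : ℝ) : HasDerivAt (fun q => ‖z‖ ^ 2 - q) (-1) t := (hasDerivAt_id t).const_sub _
  have hsmooth (y : E) : ContDiffAt ℝ 2 (fun y => ‖z‖ ^ 2 - ‖y - 0‖ ^ 2) y :=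
    contDiffAt_const.sub (contDiffAt_norm_sub_sq 0 y)
  refine fun x hx => ⟨(hsmooth x).mul (contDiffAt_rpow_norm_sub_sq (hne x hx) _), ?_⟩
  filter_upwards [isOpen_ball.mem_nhds hx] with y hy
  have hyz := hne y hy
  have hq := norm_sub_sq_pos hyz
  rw [laplacian_mul (hsmooth y) (contDiffAt_rpow_norm_sub_sq hyz _),
    laplacian_rpow_norm_sub_sq hyz, gradient_rpow_norm_sub_sq hyz,
    gradient_radial (φ := fun q => ‖z‖ ^ 2 - q) (hderiv _),
    laplacian_radial (φ := fun q => ‖z‖ ^ 2 - q) (Eventually.of_forall hderiv)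
      (hasDerivAt_const _ _), Real.rpow_sub_one hq.ne', Pi.zero_apply]
  simp only [sub_zero, inner_smul_left, inner_smul_right, inner_sub_right,
    real_inner_self_eq_norm_sq, norm_sub_sq_real y z, conj_trivial] at hq ⊢
  field_simp
  ring

variable [MeasurableSpace E] [BorelSpace E] {μ : Measure E} [μ.IsAddHaarMeasure] [Nontrivial E]
  {z : E} {r R : ℝ}

theorem integral_sphere_inv_norm_sub_pow (hr : 0 ≤ r) (hrz : r < ‖z‖) :
    ∫ θ : sphere (0 : E) 1, (‖r • (θ : E) - z‖ ^ Module.finrank ℝ E)⁻¹ ∂μ.toSphere =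
      μ.toSphere.real univ * (‖z‖ ^ 2 * (‖z‖ ^ Module.finrank ℝ E)⁻¹ * (‖z‖ ^ 2 - r ^ 2)⁻¹) := by
  have hpos : 0 < ‖z‖ ^ 2 - r ^ 2 := sub_pos.2 (by gcongr)
  have hmean := integral_sphere_eq_of_harmonicOnNhd (μ := μ) (harmonicOnNhd_poissonKernel z) hr hrz
  simp only [rpow_sq_neg_half (norm_nonneg _), sub_zero, norm_smul, norm_eq_of_mem_sphere, mul_one,
    Real.norm_of_nonneg hr, integral_const_mul, norm_zero, zero_sub, norm_neg] at hmean
  refine mul_left_cancel₀ hpos.ne' (hmean.trans ?_)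
  field_simp
  ring

theorem setIntegral_ball_inv_norm_sub_pow (hR : 0 ≤ R) (hRz : R < ‖z‖) :
    ∫ y in ball 0 R, (‖y - z‖ ^ Module.finrank ℝ E)⁻¹ ∂μ =
      μ.toSphere.real univ * ∫ r in (0 : ℝ)..R, r ^ (Module.finrank ℝ E - 1) *
        (‖z‖ ^ 2 * (‖z‖ ^ Module.finrank ℝ E)⁻¹ * (‖z‖ ^ 2 - r ^ 2)⁻¹) := by
  set f : E → ℝ := (ball 0 R).indicator fun y => (‖y - z‖ ^ Module.finrank ℝ E)⁻¹
  have hf : Integrable f μ := by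
    refine (integrable_indicator_iff measurableSet_ball).2 (IntegrableOn.mono_set
      (ContinuousOn.integrableOn_compact (isCompact_closedBall 0 R)
        (ContinuousOn.inv₀ (by fun_prop) fun y hy => ?_)) ball_subset_closedBall)
    refine pow_ne_zero _ (norm_ne_zero_iff.2 (sub_ne_zero.2 ?_))
    rintro rfl
    exact hRz.not_ge (by simpa using hy)
  rw [← integral_indicator measurableSet_ball, integral_eq_integral_Ioi_integral_sphere hf,
    ← intervalIntegral.integral_const_mul, intervalIntegral.integral_of_le hR,
    integral_Ioc_eq_integral_Ioo, ← Ioi_inter_Iio, ← setIntegral_indicator measurableSet_Iio]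
  refine setIntegral_congr_fun measurableSet_Ioi fun r (hr : 0 < r) => ?_
  by_cases hrR : r < R
  · have hmem (θ : sphere (0 : E) 1) : r • (θ : E) ∈ ball (0 : E) R := by
      simpa [norm_smul, abs_of_pos hr] using hrR
    simp only [f, indicator_of_mem (hmem _), indicator_of_mem (mem_Iio.2 hrR),
      integral_sphere_inv_norm_sub_pow hr.le (hrR.trans hRz)]
    ring
  · have hmem (θ : sphere (0 : E) 1) : r • (θ : E) ∉ ball (0 : E) R := by
      simpa [norm_smul, abs_of_pos hr] using hrR
    simp only [f, indicator_of_notMem (hmem _), integral_zero, mul_zero, mem_Iio, hrR,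
      not_false_eq_true, indicator_of_notMem]

end PoissonKernel

section BallPotential

theorem rpow_sq_div_sq_half {a b : ℝ} (ha : 0 ≤ a) (hb : 0 ≤ b) (n : ℕ) :
    (a ^ 2 / b ^ 2) ^ (n / 2 : ℝ) = (a / b) ^ n := by
  rw [← div_pow, ← Real.rpow_natCast_mul (div_nonneg ha hb), Nat.cast_ofNat,
    mul_div_cancel₀ _ two_ne_zero, Real.rpow_natCast]

variable {n : ℕ}

theorem integral_eq_profileTime (hn : n ≠ 0) {R d : ℝ} (hR : 0 ≤ R) (hRd : R < d) :
    n * ∫ r in (0 : ℝ)..R, r ^ (n - 1) * (d ^ 2 * (d ^ n)⁻¹ * (d ^ 2 - r ^ 2)⁻¹) =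
      profileTime (2 / n) ((R / d) ^ n) := by
  have hd : 0 < d := hR.trans_lt hRd
  have hn' : (n : ℝ) ≠ 0 := Nat.cast_ne_zero.2 hn
  have hbounds {r : ℝ} (hr : r ∈ uIcc 0 R) : 0 ≤ r ∧ 0 < d ^ 2 - r ^ 2 := by
    rw [uIcc_of_le hR] at hr
    exact ⟨hr.1, by nlinarith [hr.1, hr.2]⟩
  have hderiv : ∀ r ∈ uIcc 0 R, HasDerivAt (fun r => profileTime (2 / n) ((r / d) ^ n))
      (n * (r ^ (n - 1) * (d ^ 2 * (d ^ n)⁻¹ * (d ^ 2 - r ^ 2)⁻¹))) r := by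
    intro r hr
    obtain ⟨hr0, hrd⟩ := hbounds hr
    have hlt : r / d < 1 := (div_lt_one hd).2 (by nlinarith)
    have hpow : ((r / d) ^ n) ^ (2 / n : ℝ) = (r / d) ^ 2 := by
      rw [← Real.rpow_natCast_mul (by positivity), mul_div_cancel₀ _ hn', Real.rpow_ofNat]
    refine ((hasDerivAt_profileTime (p := 2 / n) (by positivity)
      ⟨by positivity, pow_lt_one₀ (by positivity) hlt hn⟩).comp r
      (((hasDerivAt_id r).div_const d).pow n)).congr_deriv ?_
    obtain ⟨k, rfl⟩ := Nat.exists_eq_succ_of_ne_zero hn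
    have hsub : 1 - (r / d) ^ 2 = (d ^ 2 - r ^ 2) / d ^ 2 := by field_simp
    rw [id, hpow, hsub]
    simp only [Nat.succ_eq_add_one, Nat.add_sub_cancel, div_pow, pow_succ]
    field_simp
  rw [← intervalIntegral.integral_const_mul, intervalIntegral.integral_eq_sub_of_hasDerivAt hderiv]
  · simp [hn, profileTime_zero]
  · refine ContinuousOn.intervalIntegrable (ContinuousOn.mul (by fun_prop) (ContinuousOn.mul
      (by fun_prop) (ContinuousOn.mul (by fun_prop) (ContinuousOn.inv₀ (by fun_prop) ?_))))
    exact fun r hr => (hbounds hr).2.ne'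

theorem sphereArea_pos (hn : n ≠ 0) : 0 < sphereArea n := by
  have hball : 0 < (volume : Measure (EuclideanSpace ℝ (Fin n))).real (ball 0 1) :=
    ENNReal.toReal_pos (measure_ball_pos _ _ one_pos).ne' measure_ball_lt_top.ne
  rw [sphereArea, Measure.toSphere_real_apply_univ, finrank_euclideanSpace_fin]
  positivity

variable {c x : EuclideanSpace ℝ (Fin n)} {R : ℝ}

theorem potentialV_indicator_ball (hn : n ≠ 0) (hR : 0 ≤ R) (hx : R < ‖x - c‖) :
    potentialV ((ball c R).indicator fun _ => (1 : ℝ)) x =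
      profileTime (2 / n) ((R / ‖x - c‖) ^ n) := by
  have := NeZero.mk hn
  have htranslate : ∫ ζ, (ball c R).indicator (fun _ => (1 : ℝ)) ζ / ‖x - ζ‖ ^ n =
      ∫ y in ball 0 R, (‖y - (x - c)‖ ^ n)⁻¹ := by
    rw [← integral_indicator measurableSet_ball, ← integral_add_left_eq_self _ c]
    congr 1 with y
    have hnorm : ‖x - (c + y)‖ = ‖y - (x - c)‖ := by rw [norm_sub_rev]; congr 1; abel
    simp only [indicator, mem_ball_iff_norm, add_sub_cancel_left, sub_zero, hnorm, ite_div, one_div,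
      zero_div]
  have hball := setIntegral_ball_inv_norm_sub_pow (μ := volume) hR hx
  rw [finrank_euclideanSpace_fin] at hball
  have harea := (sphereArea_pos hn).ne'
  rw [potentialV, htranslate, hball, ← integral_eq_profileTime hn hR hx, ← mul_assoc, ← sphereArea,
    div_mul_cancel₀ _ harea]

theorem potentialV_congr_ae {ρ σ : EuclideanSpace ℝ (Fin n) → ℝ} (h : ρ =ᵐ[volume] σ) :
    potentialV ρ = potentialV σ := by
  ext x
  exact congr_arg _ (integral_congr_ae (h.div (EventuallyEq.refl _ _)))

theorem potentialV_indicator_closedBall (hR : R ≠ 0) :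
    potentialV ((closedBall c R).indicator fun _ => (1 : ℝ)) =
      potentialV ((ball c R).indicator fun _ => (1 : ℝ)) := by
  refine potentialV_congr_ae (indicator_ae_eq_of_ae_eq_set ?_)
  rw [← ball_union_sphere]
  exact union_ae_eq_left_of_ae_eq_empty
    (ae_eq_empty.2 (Measure.addHaar_sphere_of_ne_zero volume c hR))

end BallPotential

section PotentialIntegral

theorem continuousOn_comp_const_sub {E G : Type*} [AddGroup E] [TopologicalSpace E]
    [ContinuousSub E] [TopologicalSpace G] {k : E → G} (hk : ContinuousOn k {0}ᶜ) {x : E}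
    {K : Set E} (hx : x ∉ K) : ContinuousOn (fun ζ => k (x - ζ)) K :=
  hk.comp (by fun_prop) fun ζ hζ => sub_ne_zero.2 fun h => hx (h ▸ hζ)

namespace IsDensity

variable {n : ℕ} {ρ : EuclideanSpace ℝ (Fin n) → ℝ}

section Kernel

variable {G : Type*} [NormedAddCommGroup G] [NormedSpace ℝ G] {k : EuclideanSpace ℝ (Fin n) → G}
  {x : EuclideanSpace ℝ (Fin n)}

theorem integrable_smul (hρ : IsDensity ρ) {g : EuclideanSpace ℝ (Fin n) → G}
    (hg : ContinuousOn g (tsupport ρ)) : Integrable (fun ζ => ρ ζ • g ζ) := by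
  refine (integrableOn_iff_integrable_of_support_subset (s := tsupport ρ) ?_).1
    ((hg.integrableOn_compact hρ.hasCompactSupport).bdd_smul 1
      hρ.aemeasurable.aestronglyMeasurable.restrict (Eventually.of_forall fun y => ?_))
  · exact (Function.support_smul_subset_left ρ g).trans (subset_tsupport ρ)
  · rw [Real.norm_of_nonneg (hρ.nonneg y)]
    exact hρ.le_one y

theorem integrable (hρ : IsDensity ρ) : Integrable ρ := by
  simpa using hρ.integrable_smul (g := fun _ => (1 : ℝ)) continuousOn_const

theorem integrable_smul_comp_sub (hρ : IsDensity ρ) (hk : ContinuousOn k {0}ᶜ)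
    (hx : x ∈ (tsupport ρ)ᶜ) : Integrable (fun ζ => ρ ζ • k (x - ζ)) :=
  hρ.integrable_smul (continuousOn_comp_const_sub hk hx)

theorem hasFDerivAt_integral_smul_comp_sub (hρ : IsDensity ρ)
    (hk : ContDiffOn ℝ 1 k {0}ᶜ) (hx : x ∈ (tsupport ρ)ᶜ) :
    HasFDerivAt (fun x => ∫ ζ, ρ ζ • k (x - ζ)) (∫ ζ, ρ ζ • fderiv ℝ k (x - ζ)) x := by
  have hk' : ContinuousOn (fderiv ℝ k) {0}ᶜ :=
    hk.continuousOn_fderiv_of_isOpen isOpen_compl_singleton le_rfl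
  have hopen : IsOpen (tsupport ρ)ᶜ := (isClosed_tsupport ρ).isOpen_compl
  obtain ⟨δ, hδ, hsub⟩ := nhds_basis_closedBall.mem_iff.1 (hopen.mem_nhds hx)
  have hne {x' ζ : EuclideanSpace ℝ (Fin n)} (hx' : x' ∈ closedBall x δ) (hζ : ζ ∈ tsupport ρ) :
      x' - ζ ≠ 0 := sub_ne_zero.2 fun h => hsub hx' (h ▸ hζ)
  have hcont : ContinuousOn (fun p : EuclideanSpace ℝ (Fin n) × EuclideanSpace ℝ (Fin n) =>
      fderiv ℝ k (p.1 - p.2)) (closedBall x δ ×ˢ tsupport ρ) :=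
    hk'.comp (by fun_prop) fun p hp => hne hp.1 hp.2
  obtain ⟨C, hC⟩ := ((isCompact_closedBall x δ).prod
    hρ.hasCompactSupport.isCompact).exists_bound_of_continuousOn hcont
  refine hasFDerivAt_integral_of_dominated_of_fderiv_le (𝕜 := ℝ)
    (F := fun x ζ => ρ ζ • k (x - ζ)) (F' := fun x ζ => ρ ζ • fderiv ℝ k (x - ζ))
    (bound := fun ζ => ρ ζ * C) (ball_mem_nhds x hδ) ?_
    (hρ.integrable_smul_comp_sub hk.continuousOn hx)
    (hρ.integrable_smul_comp_sub hk' hx).aestronglyMeasurable ?_ (hρ.integrable.mul_const C) ?_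
  · filter_upwards [hopen.mem_nhds hx] with x' hx'
    exact (hρ.integrable_smul_comp_sub hk.continuousOn hx').aestronglyMeasurable
  · refine Eventually.of_forall fun ζ x' hx' => ?_
    rw [norm_smul, Real.norm_of_nonneg (hρ.nonneg ζ)]
    by_cases hζ : ζ ∈ tsupport ρ
    · exact mul_le_mul_of_nonneg_left (hC (x', ζ) ⟨ball_subset_closedBall hx', hζ⟩) (hρ.nonneg ζ)
    · simp [image_eq_zero_of_notMem_tsupport hζ]
  · refine Eventually.of_forall fun ζ x' hx' => ?_
    by_cases hζ : ζ ∈ tsupport ρ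
    · have hk_diff : DifferentiableAt ℝ k (x' - ζ) := (hk.contDiffAt
        (isOpen_compl_singleton.mem_nhds (hne (ball_subset_closedBall hx') hζ))).differentiableAt
        one_ne_zero
      exact (hk_diff.hasFDerivAt.comp x' ((hasFDerivAt_id x').sub_const ζ)).const_smul (ρ ζ)
    · simpa [image_eq_zero_of_notMem_tsupport hζ] using hasFDerivAt_const (0 : G) x'

theorem contDiffOn_integral_smul_comp_sub (hρ : IsDensity ρ) {m : ℕ}
    (hk : ContDiffOn ℝ (m + 1) k {0}ᶜ) :
    ContDiffOn ℝ m (fun x => ∫ ζ, ρ ζ • k (x - ζ)) (tsupport ρ)ᶜ := by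
  have hopen : IsOpen (tsupport ρ)ᶜ := (isClosed_tsupport ρ).isOpen_compl
  have hfderiv {x : EuclideanSpace ℝ (Fin n)} (hx : x ∈ (tsupport ρ)ᶜ) :=
    hρ.hasFDerivAt_integral_smul_comp_sub (hk.of_le (by simp)) hx
  induction m generalizing G with
  | zero =>
    exact contDiffOn_zero.2 fun x hx => (hfderiv hx).continuousAt.continuousWithinAt
  | succ m ih =>
    push_cast at hk ⊢
    have hk' := hk.fderiv_of_isOpen isOpen_compl_singleton le_rfl
    refine (contDiffOn_succ_iff_fderiv_of_isOpen hopen).2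
      ⟨fun x hx => (hfderiv hx).differentiableAt.differentiableWithinAt, by simp, ?_⟩
    exact (ih hk' fun hx => hρ.hasFDerivAt_integral_smul_comp_sub (hk'.of_le (by simp)) hx).congr
      fun x hx => (hfderiv hx).fderiv

end Kernel

variable {k : EuclideanSpace ℝ (Fin n) → ℝ} {x : EuclideanSpace ℝ (Fin n)}

theorem inner_gradient_integral_mul_comp_sub (hρ : IsDensity ρ) (hk : ContDiffOn ℝ 1 k {0}ᶜ)
    (hx : x ∈ (tsupport ρ)ᶜ) (v : EuclideanSpace ℝ (Fin n)) :
    inner ℝ (∇ (fun x => ∫ ζ, ρ ζ * k (x - ζ)) x) v =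
      ∫ ζ, ρ ζ * inner ℝ (∇ k (x - ζ)) v := by
  have hk' : ContinuousOn (fderiv ℝ k) {0}ᶜ :=
    hk.continuousOn_fderiv_of_isOpen isOpen_compl_singleton le_rfl
  have hfderiv := (hρ.hasFDerivAt_integral_smul_comp_sub hk hx).fderiv
  simp only [smul_eq_mul] at hfderiv
  rw [inner_gradient_left, hfderiv, ContinuousLinearMap.integral_apply
    (hρ.integrable_smul_comp_sub hk' hx)]
  simp only [inner_gradient_left, _root_.smul_apply, smul_eq_mul]

set_option maxSynthPendingDepth 3 in
theorem laplacian_integral_mul_comp_sub (hρ : IsDensity ρ) (hk : ContDiffOn ℝ 2 k {0}ᶜ)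
    (hx : x ∈ (tsupport ρ)ᶜ) :
    Δ (fun x => ∫ ζ, ρ ζ * k (x - ζ)) x = ∫ ζ, ρ ζ * Δ k (x - ζ) := by
  have hk' : ContDiffOn ℝ 1 (fderiv ℝ k) {0}ᶜ :=
    hk.fderiv_of_isOpen isOpen_compl_singleton (by norm_num)
  have hk'' : ContinuousOn (fderiv ℝ (fderiv ℝ k)) {0}ᶜ :=
    hk'.continuousOn_fderiv_of_isOpen isOpen_compl_singleton le_rfl
  have hint : Integrable (fun ζ => ρ ζ • fderiv ℝ (fderiv ℝ k) (x - ζ)) :=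
    hρ.integrable_smul_comp_sub hk'' hx
  have hfderiv : fderiv ℝ (fun x => ∫ ζ, ρ ζ * k (x - ζ)) =ᶠ[𝓝 x]
      fun x => ∫ ζ, ρ ζ • fderiv ℝ k (x - ζ) := by
    filter_upwards [(isClosed_tsupport ρ).isOpen_compl.mem_nhds hx] with y hy
    exact (hρ.hasFDerivAt_integral_smul_comp_sub (hk.of_le (by norm_num)) hy).fderiv
  have hterm (v : EuclideanSpace ℝ (Fin n)) :
      (∫ ζ, ρ ζ • fderiv ℝ (fderiv ℝ k) (x - ζ)) v v =
        ∫ ζ, ρ ζ * fderiv ℝ (fderiv ℝ k) (x - ζ) v v := by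
    rw [ContinuousLinearMap.integral_apply hint,
      ContinuousLinearMap.integral_apply (hint.apply_continuousLinearMap v)]
    rfl
  simp only [laplacian_eq_sum_fderiv_fderiv, hfderiv.fderiv_eq,
    (hρ.hasFDerivAt_integral_smul_comp_sub hk' hx).fderiv, hterm, Finset.mul_sum]
  exact (integral_finsetSum _ fun i _ =>
    (hint.apply_continuousLinearMap _).apply_continuousLinearMap _).symm

end IsDensity

end PotentialIntegral

theorem continuousOn_laplacian {E : Type*} [NormedAddCommGroup E] [InnerProductSpace ℝ E]
    [FiniteDimensional ℝ E] {f : E → ℝ} {U : Set E} (hU : IsOpen U) (hf : ContDiffOn ℝ 2 f U) :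
    ContinuousOn (Δ f) U := by
  have hf' : ContinuousOn (fderiv ℝ (fderiv ℝ f)) U :=
    (hf.fderiv_of_isOpen hU (m := 1) (by norm_num)).continuousOn_fderiv_of_isOpen hU le_rfl
  exact (continuousOn_finsetSum _ fun i _ => (hf'.clm_apply continuousOn_const).clm_apply
    continuousOn_const).congr fun x _ => laplacian_eq_sum_fderiv_fderiv f x

section PotentialKernel

variable {n : ℕ}

/-- The kernel `(n / ω_n) |z| ^ (-n)` of `potentialV`, written as a function of `|z| ^ 2` because
`|z| ^ 2` is smooth in `z`. -/
noncomputable def potentialKernel (n : ℕ) (z : EuclideanSpace ℝ (Fin n)) : ℝ :=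
  n / sphereArea n * (‖z‖ ^ 2) ^ (-(n / 2 : ℝ))

theorem potentialV_eq_integral_mul_potentialKernel (ρ : EuclideanSpace ℝ (Fin n) → ℝ) :
    potentialV ρ = fun x => ∫ ζ, ρ ζ * potentialKernel n (x - ζ) := by
  ext x
  simp only [potentialV, potentialKernel, rpow_sq_neg_half (norm_nonneg _), div_eq_mul_inv (ρ _),
    mul_left_comm (ρ _), integral_const_mul]

variable {z : EuclideanSpace ℝ (Fin n)}

theorem potentialKernel_pos (hn : n ≠ 0) (hz : z ≠ 0) : 0 < potentialKernel n z := by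
  have harea := sphereArea_pos hn
  rw [potentialKernel]
  positivity

theorem contDiffOn_potentialKernel {k : WithTop ℕ∞} : ContDiffOn ℝ k (potentialKernel n) {0}ᶜ := by
  intro z hz
  have hpow := contDiffAt_rpow_norm_sub_sq hz (-(n / 2 : ℝ)) (k := k)
  simp only [sub_zero] at hpow
  exact (contDiffAt_const.mul hpow).contDiffWithinAt

theorem gradient_potentialKernel (hz : z ≠ 0) :
    ∇ (potentialKernel n) z =
      (-(n / sphereArea n * n * (‖z‖ ^ 2) ^ (-(n / 2 : ℝ) - 1))) • z := by
  have hderiv := (Real.hasDerivAt_rpow_const (p := -(n / 2 : ℝ))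
    (Or.inl (norm_sub_sq_pos hz).ne')).const_mul (n / sphereArea n)
  have hgrad := gradient_radial hderiv
  simp only [sub_zero] at hgrad
  refine hgrad.trans ?_
  congr 1
  ring

theorem laplacian_potentialKernel (hz : z ≠ 0) :
    Δ (potentialKernel n) z = n / sphereArea n * (2 * n * (‖z‖ ^ 2) ^ (-(n / 2 : ℝ) - 1)) := by
  have hlap := laplacian_smul (n / sphereArea n)
    (contDiffAt_rpow_norm_sub_sq hz (-(n / 2 : ℝ)) (k := 2))
  rw [laplacian_rpow_norm_sub_sq hz, finrank_euclideanSpace_fin] at hlap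
  simp only [sub_zero] at hlap
  refine hlap.trans ?_
  rw [smul_eq_mul]
  ring

theorem potentialKernel_add_gradient_add_laplacian (hz : z ≠ 0) (v : EuclideanSpace ℝ (Fin n))
    (w : ℝ) :
    n * potentialKernel n z + 2 * inner ℝ (∇ (potentialKernel n) z) v +
        w / 2 * Δ (potentialKernel n) z =
      n / sphereArea n * n * ((‖z‖ ^ 2) ^ (-(n / 2 : ℝ) - 1) *
        (‖z - v‖ ^ 2 - ‖v‖ ^ 2 + w)) := by
  rw [gradient_potentialKernel hz, laplacian_potentialKernel hz, potentialKernel, norm_sub_sq_real,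
    inner_smul_left, conj_trivial, Real.rpow_sub_one (by positivity)]
  field_simp
  ring

end PotentialKernel

section Comparison

variable {n : ℕ} {ρ : EuclideanSpace ℝ (Fin n) → ℝ} {c x : EuclideanSpace ℝ (Fin n)} {R : ℝ}

theorem IsDensity.contDiffAt_potentialV (hρ : IsDensity ρ) (hx : x ∈ (tsupport ρ)ᶜ) (m : ℕ) :
    ContDiffAt ℝ m (potentialV ρ) x := by
  rw [potentialV_eq_integral_mul_potentialKernel]
  exact (hρ.contDiffOn_integral_smul_comp_sub contDiffOn_potentialKernel).contDiffAt
    ((isClosed_tsupport ρ).isOpen_compl.mem_nhds hx)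

theorem IsDensity.laplacian_potentialV_nonneg (hρ : IsDensity ρ) (hx : x ∈ (tsupport ρ)ᶜ) :
    0 ≤ Δ (potentialV ρ) x := by
  rw [potentialV_eq_integral_mul_potentialKernel,
    hρ.laplacian_integral_mul_comp_sub contDiffOn_potentialKernel hx]
  refine integral_nonneg fun ζ => ?_
  by_cases hζ : ζ ∈ tsupport ρ
  · rw [laplacian_potentialKernel (sub_ne_zero.2 (ne_of_mem_of_not_mem hζ hx).symm)]
    have harea : 0 ≤ sphereArea n := measureReal_nonneg
    have hρζ := hρ.nonneg ζ
    positivity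
  · simp [image_eq_zero_of_notMem_tsupport hζ]

/-- The point of this combination is that the weight on the right is negative exactly on
`ball c R`. -/
theorem IsDensity.potentialV_add_gradient_add_laplacian (hρ : IsDensity ρ)
    (hx : x ∈ (tsupport ρ)ᶜ) (c : EuclideanSpace ℝ (Fin n)) (R : ℝ) :
    n * potentialV ρ x + 2 * inner ℝ (∇ (potentialV ρ) x) (x - c) +
        (‖x - c‖ ^ 2 - R ^ 2) / 2 * Δ (potentialV ρ) x =
      n / sphereArea n * n *
        ∫ ζ, ρ ζ * ((‖x - ζ‖ ^ 2) ^ (-(n / 2 : ℝ) - 1) * (‖ζ - c‖ ^ 2 - R ^ 2)) := by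
  have hkernel : Integrable fun ζ => ρ ζ * potentialKernel n (x - ζ) :=
    hρ.integrable_smul_comp_sub (contDiffOn_potentialKernel (k := 0)).continuousOn hx
  have hgradient : Integrable fun ζ => ρ ζ * inner ℝ (∇ (potentialKernel n) (x - ζ)) (x - c) := by
    simp only [inner_gradient_left]
    exact hρ.integrable_smul_comp_sub ((contDiffOn_potentialKernel.continuousOn_fderiv_of_isOpen
      isOpen_compl_singleton le_rfl).clm_apply continuousOn_const) hx
  have hlaplacian : Integrable fun ζ => ρ ζ * Δ (potentialKernel n) (x - ζ) :=
    hρ.integrable_smul_comp_sub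
      (continuousOn_laplacian isOpen_compl_singleton contDiffOn_potentialKernel) hx
  rw [potentialV_eq_integral_mul_potentialKernel,
    hρ.inner_gradient_integral_mul_comp_sub contDiffOn_potentialKernel hx,
    hρ.laplacian_integral_mul_comp_sub contDiffOn_potentialKernel hx, ← integral_const_mul,
    ← integral_const_mul, ← integral_const_mul, ← integral_const_mul,
    ← integral_add (hkernel.const_mul _) (hgradient.const_mul _),
    ← integral_add ((hkernel.const_mul _).fun_add (hgradient.const_mul _)) (hlaplacian.const_mul _)]
  congr 1 with ζ
  by_cases hζ : ζ ∈ tsupport ρ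
  · have hne := sub_ne_zero.2 (ne_of_mem_of_not_mem hζ hx).symm
    have hkey := potentialKernel_add_gradient_add_laplacian hne (x - c) (‖x - c‖ ^ 2 - R ^ 2)
    rw [sub_sub_sub_cancel_left, norm_sub_rev c ζ] at hkey
    linear_combination ρ ζ * hkey
  · simp [image_eq_zero_of_notMem_tsupport hζ]

theorem tsupport_indicator_ball_subset (c : EuclideanSpace ℝ (Fin n)) (R : ℝ) :
    tsupport ((ball c R).indicator fun _ => (1 : ℝ)) ⊆ closedBall c R :=
  closure_minimal (support_indicator_subset.trans ball_subset_closedBall) isClosed_closedBall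

theorem isDensity_indicator_ball (c : EuclideanSpace ℝ (Fin n)) (R : ℝ) :
    IsDensity ((ball c R).indicator fun _ => (1 : ℝ)) where
  aemeasurable := (measurable_const.indicator measurableSet_ball).aemeasurable
  nonneg := indicator_nonneg fun _ _ => zero_le_one
  le_one := indicator_le_self' fun _ _ => zero_le_one
  hasCompactSupport := HasCompactSupport.intro (isCompact_closedBall c R) fun _ hx =>
    indicator_of_notMem (fun h => hx (ball_subset_closedBall h)) _

/-- The bathtub principle. -/
theorem IsDensity.integral_indicator_ball_mul_le (hρ : IsDensity ρ) (hR : 0 ≤ R)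
    {w : EuclideanSpace ℝ (Fin n) → ℝ} (hw : ∀ ζ, 0 ≤ w ζ)
    (hint : Integrable fun ζ => ρ ζ * (w ζ * (‖ζ - c‖ ^ 2 - R ^ 2)))
    (hint' : Integrable fun ζ => (ball c R).indicator (fun _ => (1 : ℝ)) ζ *
      (w ζ * (‖ζ - c‖ ^ 2 - R ^ 2))) :
    ∫ ζ, (ball c R).indicator (fun _ => (1 : ℝ)) ζ * (w ζ * (‖ζ - c‖ ^ 2 - R ^ 2)) ≤
      ∫ ζ, ρ ζ * (w ζ * (‖ζ - c‖ ^ 2 - R ^ 2)) := by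
  refine integral_mono hint' hint fun ζ => ?_
  by_cases hζ : ζ ∈ ball c R
  · have hneg : ‖ζ - c‖ ^ 2 - R ^ 2 ≤ 0 := by
      rw [mem_ball_iff_norm] at hζ
      nlinarith [norm_nonneg (ζ - c)]
    simp only [indicator_of_mem hζ]
    exact mul_le_mul_of_nonpos_right (hρ.le_one ζ) (mul_nonpos_of_nonneg_of_nonpos (hw ζ) hneg)
  · have hpos : 0 ≤ ‖ζ - c‖ ^ 2 - R ^ 2 := by
      rw [mem_ball_iff_norm, not_lt] at hζ
      nlinarith
    simp only [indicator_of_notMem hζ, zero_mul]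
    exact mul_nonneg (hρ.nonneg ζ) (mul_nonneg (hw ζ) hpos)

theorem IsDensity.integrable_mul_rpow_mul (hρ : IsDensity ρ) (hx : x ∈ (tsupport ρ)ᶜ) (a : ℝ)
    (c : EuclideanSpace ℝ (Fin n)) (R : ℝ) :
    Integrable fun ζ => ρ ζ * ((‖x - ζ‖ ^ 2) ^ a * (‖ζ - c‖ ^ 2 - R ^ 2)) := by
  refine hρ.integrable_smul (ContinuousOn.mul (ContinuousOn.rpow_const (by fun_prop) fun ζ hζ =>
    Or.inl ?_) (by fun_prop))
  exact pow_ne_zero 2 (norm_ne_zero_iff.2 (sub_ne_zero.2 (ne_of_mem_of_not_mem hζ hx).symm))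

theorem mem_compl_tsupport_indicator_ball (hx : R < ‖x - c‖) :
    x ∈ (tsupport ((ball c R).indicator fun _ => (1 : ℝ)))ᶜ := fun h =>
  hx.not_ge (mem_closedBall_iff_norm.1 (tsupport_indicator_ball_subset c R h))

theorem IsDensity.gradient_add_laplacian_potentialV_ball_le (hρ : IsDensity ρ)
    (hx : x ∈ (tsupport ρ)ᶜ) (hR : 0 ≤ R) (hRx : R < ‖x - c‖)
    (hV : potentialV ((ball c R).indicator fun _ => (1 : ℝ)) x = potentialV ρ x) :
    2 * inner ℝ (∇ (potentialV ((ball c R).indicator fun _ => (1 : ℝ))) x) (x - c) +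
        (‖x - c‖ ^ 2 - R ^ 2) / 2 * Δ (potentialV ((ball c R).indicator fun _ => (1 : ℝ))) x ≤
      2 * inner ℝ (∇ (potentialV ρ) x) (x - c) +
        (‖x - c‖ ^ 2 - R ^ 2) / 2 * Δ (potentialV ρ) x := by
  have hball := isDensity_indicator_ball c R
  have hxball := mem_compl_tsupport_indicator_ball hRx
  have hle := hρ.integral_indicator_ball_mul_le hR (fun ζ => by positivity)
    (hρ.integrable_mul_rpow_mul hx (-(n / 2 : ℝ) - 1) c R)
    (hball.integrable_mul_rpow_mul hxball _ c R)
  have harea : 0 ≤ sphereArea n := measureReal_nonneg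
  have hle' := mul_le_mul_of_nonneg_left hle (by positivity : 0 ≤ n / sphereArea n * n)
  rw [← hρ.potentialV_add_gradient_add_laplacian hx,
    ← hball.potentialV_add_gradient_add_laplacian hxball, hV] at hle'
  linarith

end Comparison

section BallDerivatives

variable {n : ℕ} {q R : ℝ}

theorem rpow_div_mem_Ico (hn : n ≠ 0) (hq : R ^ 2 < q) :
    (R ^ 2 / q) ^ (n / 2 : ℝ) ∈ Ico (0 : ℝ) 1 := by
  have hq0 : 0 < q := (sq_nonneg R).trans_lt hq
  exact ⟨by positivity, Real.rpow_lt_one (by positivity) ((div_lt_one hq0).2 hq) (by positivity)⟩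

theorem hasDerivAt_rpow_div (hR : R ≠ 0) (hq : 0 < q) (a : ℝ) :
    HasDerivAt (fun q => (R ^ 2 / q) ^ a) (-a * ((R ^ 2 / q) ^ a / q)) q := by
  have hbase : R ^ 2 / q ≠ 0 := by positivity
  refine ((((hasDerivAt_const q (R ^ 2)).fun_div (hasDerivAt_id q) hq.ne')).rpow_const
    (p := a) (Or.inl hbase)).congr_deriv ?_
  rw [id, Real.rpow_sub_one hbase]
  field_simp
  ring

theorem hasDerivAt_profileTime_rpow_div (hn : n ≠ 0) (hR : R ≠ 0) (hq : R ^ 2 < q) :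
    HasDerivAt (fun q => profileTime (2 / n) ((R ^ 2 / q) ^ (n / 2 : ℝ)))
      (-(n / 2) * ((R ^ 2 / q) ^ (n / 2 : ℝ) / (q - R ^ 2))) q := by
  have hq0 : 0 < q := (sq_nonneg R).trans_lt hq
  have hw : q - R ^ 2 ≠ 0 := (sub_pos.2 hq).ne'
  have hpow : ((R ^ 2 / q) ^ (n / 2 : ℝ)) ^ (2 / n : ℝ) = R ^ 2 / q := by
    rw [← inv_div (n : ℝ) 2, Real.rpow_rpow_inv (by positivity) (by positivity)]
  refine ((hasDerivAt_profileTime (p := 2 / n) (by positivity) (rpow_div_mem_Ico hn hq)).comp q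
    (hasDerivAt_rpow_div hR hq0 _)).congr_deriv ?_
  have hsub : 1 - R ^ 2 / q = (q - R ^ 2) / q := by field_simp
  rw [hpow, hsub]
  field_simp

theorem hasDerivAt_rpow_div_div_sub (hR : R ≠ 0) (hq : R ^ 2 < q) (a : ℝ) :
    HasDerivAt (fun q => -a * ((R ^ 2 / q) ^ a / (q - R ^ 2)))
      (a * (R ^ 2 / q) ^ a * (a / (q * (q - R ^ 2)) + 1 / (q - R ^ 2) ^ 2)) q := by
  have hq0 : 0 < q := (sq_nonneg R).trans_lt hq
  have hw : q - R ^ 2 ≠ 0 := (sub_pos.2 hq).ne'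
  refine (((hasDerivAt_rpow_div hR hq0 a).fun_div
    ((hasDerivAt_id q).sub_const (R ^ 2)) hw).const_mul (-a)).congr_deriv ?_
  simp only [id]
  field_simp
  ring

variable {c x : EuclideanSpace ℝ (Fin n)}

theorem eventually_potentialV_indicator_ball_eq (hn : n ≠ 0) (hR : 0 ≤ R) (hx : R < ‖x - c‖) :
    ∀ᶠ y in 𝓝 x, potentialV ((ball c R).indicator fun _ => (1 : ℝ)) y =
      profileTime (2 / n) ((R ^ 2 / ‖y - c‖ ^ 2) ^ (n / 2 : ℝ)) := by
  have hcont : ContinuousAt (fun y => ‖y - c‖) x := by fun_prop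
  filter_upwards [hcont.eventually (lt_mem_nhds hx)] with y hy
  rw [potentialV_indicator_ball hn hR hy, rpow_sq_div_sq_half hR (norm_nonneg _)]

theorem gradient_add_laplacian_potentialV_indicator_ball (hn : n ≠ 0) (hR : 0 < R)
    (hx : R < ‖x - c‖) :
    2 * inner ℝ (∇ (potentialV ((ball c R).indicator fun _ => (1 : ℝ))) x) (x - c) +
        (‖x - c‖ ^ 2 - R ^ 2) / 2 * Δ (potentialV ((ball c R).indicator fun _ => (1 : ℝ))) x =
      -(n * (R / ‖x - c‖) ^ n * ‖x - c‖ ^ 2 / (‖x - c‖ ^ 2 - R ^ 2)) := by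
  have hq : R ^ 2 < ‖x - c‖ ^ 2 := by gcongr
  have hV : potentialV ((ball c R).indicator fun _ => (1 : ℝ)) =ᶠ[𝓝 x] fun y =>
    profileTime (2 / n) ((R ^ 2 / ‖y - c‖ ^ 2) ^ (n / 2 : ℝ)) :=
    eventually_potentialV_indicator_ball_eq hn hR.le hx
  have hderiv : ∀ᶠ q in 𝓝 (‖x - c‖ ^ 2),
      HasDerivAt (fun q => profileTime (2 / n) ((R ^ 2 / q) ^ (n / 2 : ℝ)))
        (-(n / 2) * ((R ^ 2 / q) ^ (n / 2 : ℝ) / (q - R ^ 2))) q := by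
    filter_upwards [isOpen_Ioi.mem_nhds hq] with q hq
    exact hasDerivAt_profileTime_rpow_div hn hR.ne' hq
  rw [hV.gradient_eq, (laplacian_congr_nhds hV).eq_of_nhds, gradient_radial hderiv.self_of_nhds,
    laplacian_radial hderiv (hasDerivAt_rpow_div_div_sub hR.ne' hq _), finrank_euclideanSpace_fin,
    inner_smul_left, real_inner_self_eq_norm_sq, rpow_sq_div_sq_half hR.le (norm_nonneg _),
    conj_trivial]
  have hw : ‖x - c‖ ^ 2 - R ^ 2 ≠ 0 := (sub_pos.2 hq).ne'
  have hd : ‖x - c‖ ≠ 0 := (hR.trans hx).ne'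
  generalize (R / ‖x - c‖) ^ n = m
  field_simp
  ring

end BallDerivatives

section GradientEstimate

variable {n : ℕ} {ρ : EuclideanSpace ℝ (Fin n) → ℝ} {x : EuclideanSpace ℝ (Fin n)} {m : ℝ}

theorem IsDensity.nonneg_add_inner_gradient_add_laplacian (hρ : IsDensity ρ) (hn : n ≠ 0)
    (hx : x ∈ (tsupport ρ)ᶜ) (hm : m ∈ Ioo (0 : ℝ) 1)
    (hV : potentialV ρ x = profileTime (2 / n) m) (v : EuclideanSpace ℝ (Fin n)) :
    0 ≤ n * m + 2 * inner ℝ (∇ (potentialV ρ) x) v + ‖v‖ ^ 2 / 2 * Δ (potentialV ρ) x := by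
  obtain rfl | hv := eq_or_ne v 0
  · simpa using mul_nonneg n.cast_nonneg hm.1.le
  -- The ball below has the same potential as `ρ` at `x`, and `x - c` is a multiple of `v`.
  set s := m ^ (n : ℝ)⁻¹
  have hs0 : 0 < s := Real.rpow_pos_of_pos hm.1 _
  have hs1 : s < 1 := Real.rpow_lt_one hm.1.le hm.2 (by positivity)
  have hsn : s ^ n = m := Real.rpow_inv_natCast_pow hm.1.le hn
  have ht : 0 < 1 - s ^ 2 := by nlinarith
  set c := x - (1 - s ^ 2)⁻¹ • v
  have hxc : x - c = (1 - s ^ 2)⁻¹ • v := sub_sub_cancel x _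
  have hd : 0 < ‖x - c‖ := by
    rw [hxc]
    exact norm_pos_iff.2 (smul_ne_zero (inv_ne_zero ht.ne') hv)
  have hd_eq : ‖x - c‖ = ‖v‖ / (1 - s ^ 2) := by
    rw [hxc, norm_smul, norm_inv, Real.norm_of_nonneg ht.le, div_eq_inv_mul]
  have hR : 0 < s * ‖x - c‖ := mul_pos hs0 hd
  have hRx : s * ‖x - c‖ < ‖x - c‖ := mul_lt_of_lt_one_left hd hs1
  have hratio : (s * ‖x - c‖ / ‖x - c‖) ^ n = m := by rw [mul_div_cancel_right₀ _ hd.ne', hsn]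
  have hle := hρ.gradient_add_laplacian_potentialV_ball_le hx hR.le hRx
    (by rw [potentialV_indicator_ball hn hR.le hRx, hratio, hV])
  rw [gradient_add_laplacian_potentialV_indicator_ball hn hR hRx, hratio] at hle
  have hgap : ‖x - c‖ ^ 2 - (s * ‖x - c‖) ^ 2 = (1 - s ^ 2) * ‖x - c‖ ^ 2 := by ring
  rw [hgap, mul_div_mul_right _ _ (pow_ne_zero 2 hd.ne'), hd_eq, hxc, inner_smul_right] at hle
  have hscaled := mul_le_mul_of_nonneg_left hle ht.le
  field_simp at hscaled
  linarith

theorem IsDensity.two_mul_norm_gradient_potentialV_sq_le (hρ : IsDensity ρ) (hn : n ≠ 0)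
    (hx : x ∈ (tsupport ρ)ᶜ) (hm : m ∈ Ioo (0 : ℝ) 1)
    (hV : potentialV ρ x = profileTime (2 / n) m) :
    2 * ‖∇ (potentialV ρ) x‖ ^ 2 ≤ n * m * Δ (potentialV ρ) x := by
  set g := ∇ (potentialV ρ) x
  have hdiscrim : discrim (‖g‖ ^ 2 / 2 * Δ (potentialV ρ) x) (2 * ‖g‖ ^ 2) (n * m) ≤ 0 := by
    refine discrim_le_zero fun t => ?_
    have hquad := hρ.nonneg_add_inner_gradient_add_laplacian hn hx hm hV (t • g)
    rw [inner_smul_right, real_inner_self_eq_norm_sq, norm_smul, mul_pow, Real.norm_eq_abs,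
      sq_abs] at hquad
    linarith
  obtain hg | hg := (sq_nonneg ‖g‖).eq_or_lt
  · rw [← hg, mul_zero]
    exact mul_nonneg (mul_nonneg n.cast_nonneg hm.1.le) (hρ.laplacian_potentialV_nonneg hx)
  · rw [discrim] at hdiscrim
    nlinarith

end GradientEstimate

section ProfileTransform

/-- The function of `M (V_ρ)` that defines `profileTransform`. -/
noncomputable def profileOuter (n : ℕ) (m : ℝ) : ℝ :=
  if n = 2 then Real.log m else m ^ (((n : ℝ) - 2) / n)

/-- The constant in the derivative of `profileOuter n`, which is this constant times
`m ^ (-(2 / n))`. -/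
noncomputable def profileOuterCoeff (n : ℕ) : ℝ :=
  if n = 2 then 1 else ((n : ℝ) - 2) / n

variable {n : ℕ} {M : ℝ → ℝ}

theorem profileOuterCoeff_nonneg (hn : 2 ≤ n) : 0 ≤ profileOuterCoeff n := by
  rw [profileOuterCoeff]
  split_ifs
  · exact zero_le_one
  · exact div_nonneg (sub_nonneg.2 (by exact_mod_cast hn)) n.cast_nonneg

theorem hasDerivAt_profileOuter (hn : n ≠ 0) {m : ℝ} (hm : 0 < m) :
    HasDerivAt (profileOuter n) (profileOuterCoeff n * m ^ (-(2 / n : ℝ))) m := by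
  obtain rfl | h2 := eq_or_ne n 2
  · have houter : profileOuter 2 = Real.log := by
      ext m
      simp [profileOuter]
    simpa [houter, profileOuterCoeff, Real.rpow_neg_one] using Real.hasDerivAt_log hm.ne'
  · have houter : profileOuter n = fun m => m ^ (((n : ℝ) - 2) / n) := by
      ext m
      simp [profileOuter, h2]
    have hexp : ((n : ℝ) - 2) / n - 1 = -(2 / n) := by
      field_simp
      ring
    rw [houter, profileOuterCoeff, if_neg h2, ← hexp]
    exact Real.hasDerivAt_rpow_const (Or.inl hm.ne')

namespace IsProfile

theorem hasDerivAt_profileOuter_comp (hM : IsProfile n M) (hn : 2 ≤ n) {t : ℝ} (ht : 0 < t) :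
    HasDerivAt (fun t => profileOuter n (M t))
      (profileOuterCoeff n * (M t ^ (-(2 / n : ℝ)) - 1)) t := by
  have hpos := (hM.mem_Ioo hn ht).1
  refine ((hasDerivAt_profileOuter (by lia) hpos).comp t (hM.hasDerivAt ht)).congr_deriv ?_
  rw [mul_assoc, mul_sub, mul_one, ← Real.rpow_add hpos, neg_add_cancel, Real.rpow_zero]

theorem hasDerivAt_deriv_profileOuter_comp (hM : IsProfile n M) (hn : 2 ≤ n) {t : ℝ}
    (ht : 0 < t) :
    HasDerivAt (fun t => profileOuterCoeff n * (M t ^ (-(2 / n : ℝ)) - 1))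
      (-(profileOuterCoeff n * (2 / n) * (M t ^ (-(2 / n : ℝ)) - 1) / M t)) t := by
  have hpos := (hM.mem_Ioo hn ht).1
  refine ((((hM.hasDerivAt ht).rpow_const (p := -(2 / n : ℝ)) (Or.inl hpos.ne')).sub_const
    1).const_mul (profileOuterCoeff n)).congr_deriv ?_
  have hcancel : M t ^ (2 / n : ℝ) * M t ^ (-(2 / n : ℝ)) = 1 := by
    rw [← Real.rpow_add hpos, add_neg_cancel, Real.rpow_zero]
  rw [Real.rpow_sub_one hpos.ne']
  linear_combination (profileOuterCoeff n * (2 / n) / M t) * hcancel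

end IsProfile

variable {ρ : EuclideanSpace ℝ (Fin n) → ℝ} {x : EuclideanSpace ℝ (Fin n)}

theorem IsDensity.potentialV_pos (hρ : IsDensity ρ) (hn : n ≠ 0) (hρ0 : ¬ρ =ᵐ[volume] 0)
    (hx : x ∈ (tsupport ρ)ᶜ) : 0 < potentialV ρ x := by
  have hkernel {ζ : EuclideanSpace ℝ (Fin n)} (hζ : ρ ζ ≠ 0) : 0 < potentialKernel n (x - ζ) :=
    potentialKernel_pos hn (sub_ne_zero.2 (ne_of_mem_of_not_mem (subset_tsupport ρ hζ) hx).symm)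
  have hnonneg (ζ : EuclideanSpace ℝ (Fin n)) : 0 ≤ ρ ζ * potentialKernel n (x - ζ) := by
    by_cases hζ : ρ ζ = 0
    · rw [hζ, zero_mul]
    · exact mul_nonneg (hρ.nonneg ζ) (hkernel hζ).le
  have hint : Integrable fun ζ => ρ ζ * potentialKernel n (x - ζ) :=
    hρ.integrable_smul_comp_sub (contDiffOn_potentialKernel (k := 0)).continuousOn hx
  rw [potentialV_eq_integral_mul_potentialKernel]
  refine (integral_nonneg hnonneg).lt_of_ne fun h => hρ0 ?_
  filter_upwards [(integral_eq_zero_iff_of_nonneg hnonneg hint).1 h.symm] with ζ hζ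
  by_contra hne
  exact mul_ne_zero hne (hkernel hne).ne' hζ

theorem contDiffAt_profileTransform (hM : IsProfile n M) (hρ : IsDensity ρ) (hn : 2 ≤ n)
    (hρ0 : ¬ρ =ᵐ[volume] 0) (hx : x ∈ (tsupport ρ)ᶜ) :
    ContDiffAt ℝ 2 (profileTransform M ρ) x := by
  have hV := hρ.potentialV_pos (by lia) hρ0 hx
  have hMV : ContDiffAt ℝ 2 (fun y => M (potentialV ρ y)) x :=
    ((hM.contDiffOn hn 2).contDiffAt (Ioi_mem_nhds hV)).comp x (hρ.contDiffAt_potentialV hx 2)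
  have hpos : M (potentialV ρ x) ≠ 0 := (hM.mem_Ioo hn hV).1.ne'
  by_cases h2 : n = 2
  · have hlog : profileTransform M ρ = fun y => Real.log (M (potentialV ρ y)) := by
      ext y
      rw [profileTransform, if_pos h2]
    exact hlog ▸ hMV.log hpos
  · have hrpow : profileTransform M ρ =
        fun y => M (potentialV ρ y) ^ (((n : ℝ) - 2) / n) := by
      ext y
      rw [profileTransform, if_neg h2]
    exact hrpow ▸ hMV.rpow_const_of_ne hpos

theorem laplacian_profileTransform_nonneg (hM : IsProfile n M) (hρ : IsDensity ρ) (hn : 2 ≤ n)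
    (hρ0 : ¬ρ =ᵐ[volume] 0) (hx : x ∈ (tsupport ρ)ᶜ) : 0 ≤ Δ (profileTransform M ρ) x := by
  have hn0 : n ≠ 0 := by lia
  have hV := hρ.potentialV_pos hn0 hρ0 hx
  have hm := hM.mem_Ioo hn hV
  have hgrad := hρ.two_mul_norm_gradient_potentialV_sq_le hn0 hx hm
    (hM.profileTime_apply hn hV.le).symm
  have hderiv : ∀ᶠ t in 𝓝 (potentialV ρ x), HasDerivAt (fun t => profileOuter n (M t))
      (profileOuterCoeff n * (M t ^ (-(2 / n : ℝ)) - 1)) t := by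
    filter_upwards [lt_mem_nhds hV] with t ht
    exact hM.hasDerivAt_profileOuter_comp hn ht
  have hlap : Δ (profileTransform M ρ) x = profileOuterCoeff n *
      (M (potentialV ρ x) ^ (-(2 / n : ℝ)) - 1) / (n * M (potentialV ρ x)) *
        (n * M (potentialV ρ x) * Δ (potentialV ρ) x - 2 * ‖∇ (potentialV ρ) x‖ ^ 2) := by
    refine (laplacian_comp (hρ.contDiffAt_potentialV hx 2) hderiv
      (hM.hasDerivAt_deriv_profileOuter_comp hn hV)).trans ?_
    have hm0 := hm.1.ne'
    field_simp
    ring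
  have hpow : 1 ≤ M (potentialV ρ x) ^ (-(2 / n : ℝ)) :=
    Real.one_le_rpow_of_pos_of_le_one_of_nonpos hm.1 hm.2.le
      (neg_nonpos.2 (two_div_natCast_pos hn).le)
  rw [hlap]
  exact mul_nonneg (div_nonneg (mul_nonneg (profileOuterCoeff_nonneg hn) (sub_nonneg.2 hpow))
    (mul_nonneg n.cast_nonneg hm.1.le)) (sub_nonneg.2 hgrad)

theorem profileTransform_eq_zero (hM : M 0 = 0) (hn : 2 < n) (hρ : ρ =ᵐ[volume] 0) :
    profileTransform M ρ = 0 := by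
  have hexp : ((n : ℝ) - 2) / n ≠ 0 :=
    div_ne_zero (sub_ne_zero.2 (by exact_mod_cast hn.ne')) (by positivity)
  ext x
  have hV : potentialV ρ x = 0 := by
    rw [potentialV_congr_ae hρ]
    simp [potentialV]
  rw [profileTransform, if_neg hn.ne', hV, hM, Real.zero_rpow hexp, Pi.zero_apply]

theorem subharmonicOn_profileTransform (hM : IsProfile n M) (hρ : IsDensity ρ) (hn : 2 ≤ n)
    (hρ0 : n = 2 → ¬ρ =ᵐ[volume] 0) : SubharmonicOn (profileTransform M ρ) (tsupport ρ)ᶜ := by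
  have : NeZero n := ⟨by lia⟩
  by_cases hzero : ρ =ᵐ[volume] 0
  · rw [profileTransform_eq_zero hM.1 (hn.lt_of_ne' fun h => hρ0 h hzero) hzero]
    exact subharmonicOn_of_laplacian_nonneg (fun x _ => contDiffAt_const)
      fun x _ => (congr_fun (laplacian_const (c := (0 : ℝ))) x).ge
  · exact subharmonicOn_of_laplacian_nonneg
      (fun x hx => contDiffAt_profileTransform hM hρ hn hzero hx)
      fun x hx => laplacian_profileTransform_nonneg hM hρ hn hzero hx

theorem hasDerivAt_profileOuter_rpow_div (hn : n ≠ 0) {R q : ℝ} (hR : R ≠ 0) (hq : 0 < q) :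
    HasDerivAt (fun q => profileOuter n ((R ^ 2 / q) ^ (n / 2 : ℝ)))
      (-(profileOuterCoeff n * (n / 2) / R ^ 2 * (R ^ 2) ^ (n / 2 : ℝ)) *
        q ^ (-(n / 2 : ℝ))) q := by
  have hpow : ((R ^ 2 / q) ^ (n / 2 : ℝ)) ^ (-(2 / n : ℝ)) = (R ^ 2 / q)⁻¹ := by
    rw [← inv_div (n : ℝ) 2, Real.rpow_neg (by positivity),
      Real.rpow_rpow_inv (by positivity) (by positivity)]
  refine ((hasDerivAt_profileOuter hn (by positivity)).comp q
    (hasDerivAt_rpow_div hR hq _)).congr_deriv ?_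
  rw [hpow, Real.div_rpow (by positivity) hq.le, Real.rpow_neg hq.le]
  field_simp

theorem harmonicOnNhd_profileTransform_ball (hM : IsProfile n M) (hn : 2 ≤ n)
    {c : EuclideanSpace ℝ (Fin n)} {R : ℝ} (hR : 0 < R) :
    HarmonicOnNhd (profileTransform M ((ball c R).indicator fun _ => (1 : ℝ)))
      (closedBall c R)ᶜ := by
  have hn0 : n ≠ 0 := by lia
  intro x hx
  rw [mem_compl_iff, mem_closedBall_iff_norm, not_le] at hx
  have hradial : profileTransform M ((ball c R).indicator fun _ => (1 : ℝ)) =ᶠ[𝓝 x]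
      fun y => profileOuter n ((R ^ 2 / ‖y - c‖ ^ 2) ^ (n / 2 : ℝ)) := by
    have hcont : ContinuousAt (fun y => ‖y - c‖) x := by fun_prop
    filter_upwards [eventually_potentialV_indicator_ball_eq hn0 hR.le hx,
      hcont.eventually (lt_mem_nhds hx)] with y hy hRy
    have happly := hM.apply_profileTime hn0
      (rpow_div_mem_Ico hn0 (pow_lt_pow_left₀ hRy hR.le two_ne_zero))
    simp only [profileTransform, profileOuter, hy, happly]
  have hxc : x ≠ c := sub_ne_zero.1 (norm_pos_iff.1 (hR.trans hx))
  rw [harmonicAt_congr_nhds hradial]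
  refine harmonicAt_radial (φ := fun q => profileOuter n ((R ^ 2 / q) ^ (n / 2 : ℝ)))
    (C := -(profileOuterCoeff n * (n / 2) / R ^ 2 * (R ^ 2) ^ (n / 2 : ℝ))) hxc ?_
  filter_upwards [lt_mem_nhds (norm_sub_sq_pos hxc)] with q hq
  rw [finrank_euclideanSpace_fin]
  exact hasDerivAt_profileOuter_rpow_div hn0 hR.ne' hq

theorem profileTransform_indicator_closedBall {c : EuclideanSpace ℝ (Fin n)} {R : ℝ}
    (hR : R ≠ 0) : profileTransform M ((closedBall c R).indicator fun _ => (1 : ℝ)) =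
      profileTransform M ((ball c R).indicator fun _ => (1 : ℝ)) := by
  ext x
  rw [profileTransform, profileTransform, potentialV_indicator_closedBall hR]

end ProfileTransform

theorem theorem1p2 (n : ℕ) (hn : 2 ≤ n) :
    (∃ M : ℝ → ℝ, IsProfile n M) ∧
    ∀ M : ℝ → ℝ, IsProfile n M →
      (∀ ρ : EuclideanSpace ℝ (Fin n) → ℝ, IsDensity ρ → (n = 2 → ¬ ρ =ᵐ[volume] 0) →
        SubharmonicOn (profileTransform M ρ) (tsupport ρ)ᶜ) ∧
      (∀ (c : EuclideanSpace ℝ (Fin n)) (R : ℝ), 0 < R →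
        ∀ B : Set (EuclideanSpace ℝ (Fin n)), (B = ball c R ∨ B = closedBall c R) →
          InnerProductSpace.HarmonicOnNhd
            (profileTransform M (B.indicator fun _ => (1 : ℝ))) (closedBall c R)ᶜ) := by
  refine ⟨exists_isProfile hn, fun M hM => ⟨fun ρ hρ hρ0 =>
    subharmonicOn_profileTransform hM hρ hn hρ0, fun c R hR B hB => ?_⟩⟩
  obtain rfl | rfl := hB
  · exact harmonicOnNhd_profileTransform_ball hM hn hR
  · rw [profileTransform_indicator_closedBall hR.ne']
    exact harmonicOnNhd_profileTransform_ball hM hn hR
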